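/- **Model.** Let $n_B\in\mathbb N$, let $H_B$ be a Hermitian operator on $\otimes^{n_B}\mathbb C^2$ with eigenvalues $E^{(B)}_1,\dots,E^{(B)}_{2^{n_B}}$ (with multiplicity), and assume that $H_B$ is non-degenerate and non-anti-degenerate: $$\min_{i\ne j}|E^{(B)}_i-E^{(B)}_j|>0,\qquad \min_{i,j}|E^{(B)}_i+E^{(B)}_j|>0 .$$ Let $(h_i)_{i>n_B},(g_i)_{i>n_B}$ be i.i.d. random variables, uniform on $[-\frac12,\frac12]$, on a probability space $(\Omega,\mathcal F,\mathbb P)$. For $\alpha\ge 0$ and $n\ge n_B$ let $$H_n=H_B+\sum_{i=n_B+1}^{n}\bigl(h_iZ_i+\alpha^i g_iX_1X_i\bigr)\quad\text{on }\otimes^n\mathbb C^2,$$ where $Z_i,X_i$ are the Pauli matrices $Z,X$ acting on the $i$-th leg and $H_B$ acts on the first $n_B$ legs. **Labeling.** The eigenvalues of $H_n$ (with multiplicity) are labeled by $\Sigma_n=\{\pm1\}^n$, inductively in $n\ge n_B$: for $n=n_B$ the labeling is arbitrary; if the eigenvalues of $H_n$ are $E_\sigma$, $\sigma\in\Sigma_n$,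 then those of $H_n+h_{n+1}Z_{n+1}$ are $E_\sigma+h_{n+1}\mu$, $(\sigma,\mu)\in\Sigma_n\times\{\pm1\}=\Sigma_{n+1}$, and the label $(\sigma,\mu)$ is given to the eigenvalue of $H_{n+1}$ whose index in the increasing enumeration is the index of $E_\sigma+h_{n+1}\mu$ in the increasing enumeration of the eigenvalues of $H_n+h_{n+1}Z_{n+1}$ (with an arbitrary choice in case of coincidences). **Theorem.** For every $\theta\in(2/3,1)$ there is $\alpha_0\in(0,\frac12)$ such that for all $0\le\alpha\le\alpha_0$ and every model as above the following holds. Let $$\mathcal Z_n=\bigl\{(\sigma,\sigma')\in\Sigma_n^2 : |E_\sigma+E_{\sigma'}|<\alpha^{\theta n}/4\bigr\},\qquad \widehat{\mathcal Z}_n=\{\sigma\in\Sigma_n : (\sigma,\sigma')\in\mathcal Z_n\text{ for some }\sigma'\in\Sigma_n\}$$ ($\sigma'=\sigma$ is allowed). Then, almost surely, for every such labeling, $|\widehat{\mathcal Z}_n|/2^n\to 0$ as $n\to\infty$. -/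

import Mathlib

open Filter Topology MeasureTheory ProbabilityTheory

noncomputable section

namespace QuantumSun

/-- Spin configurations `Σ_n = {±1}^n`. The entry with index `j : Fin n` is the spin at
site `j + 1`, sites being numbered `1, …, n`. The product basis of `⊗^n ℂ²` is indexed by
`Config n`, and operators are given by their matrices in this basis. -/
abbrev Config (n : ℕ) : Type := Fin n → ℤˣ

/-- The Pauli matrix `Z` on the leg `j`, identity on the other legs. -/
def pauliZ {n : ℕ} (j : Fin n) : Matrix (Config n) (Config n) ℂ :=
  Matrix.diagonal fun σ => (((σ j : ℤˣ) : ℤ) : ℂ)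

/-- The Pauli matrix `X` on the leg `j`, identity on the other legs: it flips the spin `j`. -/
def pauliX {n : ℕ} (j : Fin n) : Matrix (Config n) (Config n) ℂ :=
  Matrix.of fun σ τ => if σ = Function.update τ j (-τ j) then 1 else 0

/-- The spins at the first `nB` sites (only meaningful for `nB ≤ n`). -/
def Config.bath (nB : ℕ) {n : ℕ} (σ : Config n) : Config nB :=
  fun i => if hi : (i : ℕ) < n then σ ⟨i, hi⟩ else 1

/-- The operator `H_B ⊗ 1` on `n` spins, with `H_B` acting on the first `nB` spins
(only meaningful for `nB ≤ n`). -/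
def bathOp {nB : ℕ} (HB : Matrix (Config nB) (Config nB) ℂ) (n : ℕ) :
    Matrix (Config n) (Config n) ℂ :=
  Matrix.of fun σ τ =>
    if ∀ j : Fin n, nB ≤ (j : ℕ) → σ j = τ j then HB (σ.bath nB) (τ.bath nB) else 0

/-- The Hamiltonian
`H_n = H_B + ∑_{i = nB + 1}^{n} (h_i Z_i + α^i g_i X_1 X_i)`; site `i` is `j + 1` with `j : Fin n`.
It is the Hamiltonian of the model for `n ≥ nB`. -/
def hamiltonian {nB : ℕ} (HB : Matrix (Config nB) (Config nB) ℂ) (α : ℝ) (h g : ℕ → ℝ) (n : ℕ) :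
    Matrix (Config n) (Config n) ℂ :=
  bathOp HB n + ∑ j ∈ Finset.univ.filter (fun j : Fin n => nB ≤ (j : ℕ)),
    (((h (j + 1) : ℝ) : ℂ) • pauliZ j
      + ((α ^ ((j : ℕ) + 1) * g (j + 1) : ℝ) : ℂ) • (pauliX ⟨0, j.pos⟩ * pauliX j))

theorem pauliZ_isHermitian {n : ℕ} (j : Fin n) : (pauliZ j).IsHermitian := by
  refine Matrix.isHermitian_diagonal_of_self_adjoint _ ?_
  ext σ
  simp

theorem eq_update_neg_iff {n : ℕ} (j : Fin n) (σ τ : Config n) :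
    σ = Function.update τ j (-τ j) ↔ τ = Function.update σ j (-σ j) := by
  constructor <;> (rintro rfl; simp)

theorem pauliX_isHermitian {n : ℕ} (j : Fin n) : (pauliX j).IsHermitian := by
  ext σ τ
  simp only [pauliX, Matrix.conjTranspose_apply, Matrix.of_apply, eq_update_neg_iff j τ σ]
  split_ifs <;> simp

theorem pauliX_comm {n : ℕ} (j k : Fin n) : pauliX j * pauliX k = pauliX k * pauliX j := by
  rcases eq_or_ne j k with rfl | hjk
  · rfl
  ext σ τ
  simp only [pauliX, Matrix.mul_apply, Matrix.of_apply, mul_ite, mul_one, mul_zero,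
    Finset.sum_ite_eq', Finset.mem_univ, if_true]
  rw [Function.update_of_ne hjk, Function.update_of_ne hjk.symm, Function.update_comm hjk]

theorem bathOp_isHermitian {nB : ℕ} {HB : Matrix (Config nB) (Config nB) ℂ}
    (hHB : HB.IsHermitian) (n : ℕ) : (bathOp HB n).IsHermitian := by
  ext σ τ
  simp only [bathOp, Matrix.conjTranspose_apply, Matrix.of_apply, eq_comm (a := τ _)]
  split_ifs
  · exact hHB.apply _ _
  · simp

theorem hamiltonian_isHermitian {nB : ℕ} {HB : Matrix (Config nB) (Config nB) ℂ}
    (hHB : HB.IsHermitian) (α : ℝ) (h g : ℕ → ℝ) (n : ℕ) :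
    (hamiltonian HB α h g n).IsHermitian := by
  have hr (r : ℝ) : IsSelfAdjoint (r : ℂ) := Complex.conj_ofReal r
  refine (bathOp_isHermitian hHB n).add ?_
  unfold Matrix.IsHermitian
  rw [Matrix.conjTranspose_sum]
  refine Finset.sum_congr rfl fun j _ => ?_
  rw [Matrix.conjTranspose_add, Matrix.conjTranspose_smul, Matrix.conjTranspose_smul,
    Matrix.conjTranspose_mul, (pauliZ_isHermitian j).eq, (pauliX_isHermitian j).eq,
    (pauliX_isHermitian _).eq, (hr _).star_eq, (hr _).star_eq, pauliX_comm]

/-- The eigenvalues of a Hermitian matrix, with multiplicity, enumerated in increasing order. -/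
def sortedEigenvalue {ι : Type*} [Fintype ι] [DecidableEq ι] {A : Matrix ι ι ℂ}
    (hA : A.IsHermitian) (j : Fin (Fintype.card ι)) : ℝ :=
  hA.eigenvalues₀ j.rev

/-- The eigenvalue `E_σ` of `H_n` with label `σ ∈ Σ_n`, where `L n σ` is the index of the label `σ`
in the increasing enumeration of the eigenvalues of `H_n`. -/
def level {nB : ℕ} {HB : Matrix (Config nB) (Config nB) ℂ} (hHB : HB.IsHermitian)
    (α : ℝ) (h g : ℕ → ℝ) (L : ∀ n, Config n ≃ Fin (Fintype.card (Config n)))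
    (n : ℕ) (σ : Config n) : ℝ :=
  sortedEigenvalue (hamiltonian_isHermitian hHB α h g n) (L n σ)

/-- `L` is a labeling of the eigenvalues of `H_n`, `n ≥ nB`, by configurations: for `n = nB` it is
arbitrary, and for `n ≥ nB` the label `(σ, μ) ∈ Σ_{n+1}` is given to the eigenvalue of `H_{n+1}`
whose index is that of `E_σ + h_{n+1} μ` in an increasing enumeration of the
eigenvalues of `H_n + h_{n+1} Z_{n+1}` (with an arbitrary choice if some of these coincide). -/
def IsLabeling {nB : ℕ} {HB : Matrix (Config nB) (Config nB) ℂ} (hHB : HB.IsHermitian)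
    (α : ℝ) (h g : ℕ → ℝ) (L : ∀ n, Config n ≃ Fin (Fintype.card (Config n))) : Prop :=
  ∀ n, nB ≤ n → Monotone fun j : Fin (Fintype.card (Config (n + 1))) =>
    level hHB α h g L n (Fin.init ((L (n + 1)).symm j))
      + h (n + 1) * (((L (n + 1)).symm j (Fin.last n) : ℤˣ) : ℤ)

/-- Labelings exist. -/
theorem exists_isLabeling {nB : ℕ} {HB : Matrix (Config nB) (Config nB) ℂ}
    (hHB : HB.IsHermitian) (α : ℝ) (h g : ℕ → ℝ) : ∃ L, IsLabeling hHB α h g L := by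
  have key (n : ℕ) (f : Config n → ℝ) : ∃ e : Config n ≃ Fin (Fintype.card (Config n)),
      Monotone fun j => f (e.symm j) := by
    let e := Fintype.equivFin (Config n)
    exact ⟨e.trans (Tuple.sort (fun j => f (e.symm j))).symm,
      Tuple.monotone_sort (fun j => f (e.symm j))⟩
  let L : ∀ n, Config n ≃ Fin (Fintype.card (Config n)) := fun n =>
    Nat.rec (Fintype.equivFin _) (fun n e => (key (n + 1) fun σ =>
      sortedEigenvalue (hamiltonian_isHermitian hHB α h g n) (e (Fin.init σ))
        + h (n + 1) * ((σ (Fin.last n) : ℤˣ) : ℤ)).choose) n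
  exact ⟨L, fun n _ => (key (n + 1) fun σ =>
      sortedEigenvalue (hamiltonian_isHermitian hHB α h g n) (L n (Fin.init σ))
        + h (n + 1) * ((σ (Fin.last n) : ℤˣ) : ℤ)).choose_spec⟩

/-- The set `Z_n` of anti-resonant pairs (the case `σ = σ'` is allowed). -/
def antiResonantPairs {nB : ℕ} {HB : Matrix (Config nB) (Config nB) ℂ} (hHB : HB.IsHermitian)
    (α θ : ℝ) (h g : ℕ → ℝ) (L : ∀ n, Config n ≃ Fin (Fintype.card (Config n))) (n : ℕ) :
    Set (Config n × Config n) :=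
  {p | |level hHB α h g L n p.1 + level hHB α h g L n p.2| < α ^ (θ * n) / 4}

/-- The set of configurations that are anti-resonant with some configuration. -/
def antiResonant {nB : ℕ} {HB : Matrix (Config nB) (Config nB) ℂ} (hHB : HB.IsHermitian)
    (α θ : ℝ) (h g : ℕ → ℝ) (L : ∀ n, Config n ≃ Fin (Fintype.card (Config n))) (n : ℕ) :
    Set (Config n) :=
  {σ | ∃ σ' : Config n, (σ, σ') ∈ antiResonantPairs hHB α θ h g L n}

/-- The bath Hamiltonian is non-degenerate and non-anti-degenerate: its eigenvalues (with
multiplicity) are distinct, and no sum of two of them (equal indices allowed) vanishes. -/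
structure IsNondegenerateBath {nB : ℕ} {HB : Matrix (Config nB) (Config nB) ℂ}
    (hHB : HB.IsHermitian) : Prop where
  gap : ∀ i j, i ≠ j → 0 < |hHB.eigenvalues i - hHB.eigenvalues j|
  antigap : ∀ i j, 0 < |hHB.eigenvalues i + hHB.eigenvalues j|

/-- The random variables `h_i, g_i`, `i > nB`, are i.i.d., uniform on `[-1/2, 1/2]`. -/
structure IsDisorder {Ω : Type*} [MeasurableSpace Ω] (P : Measure Ω) (nB : ℕ)
    (h g : ℕ → Ω → ℝ) : Prop where
  measurable_h : ∀ i, nB < i → Measurable (h i)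
  measurable_g : ∀ i, nB < i → Measurable (g i)
  uniform_h : ∀ i, nB < i → pdf.IsUniform (h i) (Set.Icc (-1 / 2 : ℝ) (1 / 2)) P
  uniform_g : ∀ i, nB < i → pdf.IsUniform (g i) (Set.Icc (-1 / 2 : ℝ) (1 / 2)) P
  indep : iIndepFun (fun k : {i : ℕ // nB < i} ⊕ {i : ℕ // nB < i} =>
    Sum.elim (fun i => h i.1) (fun i => g i.1) k) P

end QuantumSun

end

/-! Anti-resonances are small factors of det(H ⊗ 1 + 1 ⊗ H) = ∏ (E_σ + E_σ'). Give each pair with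
|E_σ + E_σ'| below the threshold ε_n = α^(θn)/4 the weight log(1/|E_σ + E_σ'|), and let Ψ_n be the
total weight (`potential`). The proof shows that Ψ_n grows on average at most like 2^n √n. Each
anti-resonant pair weighs at least n, so there are on average only O(2^n/√n) of them.

Passing from n to n+1 has two parts. The field h_{n+1} turns each sum s into s, s, s + 2h_{n+1} and
s - 2h_{n+1}. By Borel–Cantelli the last two are eventually never below the threshold, so Ψ exactly
doubles (`potential_unperturbed`). The coupling is handled by `lintegral_potential_add_smul_le`: the
determinant is a polynomial in g_{n+1}. On a circle of radius R' it exceeds its value at 0 by a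
factor of at most e^(Ψ+1), because non-resonant factors hardly change and resonant ones stay below
1. Jensen's inequality then leaves at most (Ψ+1)/log(R'/R) roots in the disc of radius R. Averaged
over g in [-1/2, 1/2], a near root costs at most 3 in log|det| and a far one at most 1/R. With
log(R'/R) = 12n the mean weight is multiplied by at most 1 + 1/(4n), up to an additive 3, and
`sqrt_recursion` sums this up.

The recursion starts at a random size N from which no new anti-resonance appears. There Ψ_N is
finite since almost surely no sum of levels vanishes. Fatou's lemma makes the liminf of the pair
density zero. By Weyl's inequality the number of pairs at most doubles per step, so the density is
eventually monotone and converges to zero. -/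

noncomputable section

namespace QuantumSun

open scoped Matrix.Norms.L2Operator Kronecker InnerProductSpace

/-! ### Ordered eigenvalues: Weyl's inequality, continuity, multiset of eigenvalues. -/

section Weyl

variable {E : Type*} [NormedAddCommGroup E] [InnerProductSpace ℂ E] [FiniteDimensional ℂ E]

theorem re_inner_apply_self_eq_sum {T : E →ₗ[ℂ] E} (hT : T.IsSymmetric) {n : ℕ}
    (hn : Module.finrank ℂ E = n) (x : E) :
    (⟪T x, x⟫_ℂ).re = ∑ j, hT.eigenvalues hn j * ‖⟪hT.eigenvectorBasis hn j, x⟫_ℂ‖ ^ 2 := by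
  rw [← (hT.eigenvectorBasis hn).sum_inner_mul_inner (T x) x, Complex.re_sum]
  refine Finset.sum_congr rfl fun j _ => ?_
  rw [hT, hT.apply_eigenvectorBasis, inner_smul_right, mul_assoc]
  simp only [Complex.coe_algebraMap]
  rw [Complex.re_ofReal_mul]
  congr 1
  refine (inner_mul_symm_re_eq_norm (𝕜 := ℂ) _ _).trans ?_
  rw [norm_mul, norm_inner_symm x, sq]

/-- Weyl's inequality for the ordered eigenvalues of symmetric operators. -/
theorem eigenvalues_le_add {S T : E →ₗ[ℂ] E} (hS : S.IsSymmetric) (hT : T.IsSymmetric) {n : ℕ}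
    (hn : Module.finrank ℂ E = n) {t : ℝ}
    (h : ∀ x, (⟪S x, x⟫_ℂ).re ≤ (⟪T x, x⟫_ℂ).re + t * ‖x‖ ^ 2) (i : Fin n) :
    hS.eigenvalues hn i ≤ hT.eigenvalues hn i + t := by
  -- A kernel vector is orthogonal to the eigenvectors of S after i and to those of T before i.
  -- These are n - 1 conditions, so a nonzero x exists. Eigenvalues are in decreasing order, so at x
  -- the form of S is at least its i-th eigenvalue times ‖x‖² and that of T at most its own.
  let f : E →ₗ[ℂ] ({j : Fin n // j ≠ i} → ℂ) := LinearMap.pi fun j =>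
    if i < j then (innerSL ℂ (hS.eigenvectorBasis hn j) : E →ₗ[ℂ] ℂ)
      else (innerSL ℂ (hT.eigenvectorBasis hn j) : E →ₗ[ℂ] ℂ)
  have hker : LinearMap.ker f ≠ ⊥ := by
    apply LinearMap.ker_ne_bot_of_finrank_lt
    rw [Module.finrank_fintype_fun_eq_card, hn, Fintype.card_subtype_compl]
    have := i.pos
    simp
    omega
  obtain ⟨x, hx, hx0⟩ := (Submodule.ne_bot_iff _).1 hker
  have hfx (j : Fin n) (hj : j ≠ i) : f x ⟨j, hj⟩ = 0 := by
    rw [LinearMap.mem_ker.1 hx]; rfl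
  have h1 : hS.eigenvalues hn i * ‖x‖ ^ 2 ≤ (⟪S x, x⟫_ℂ).re := by
    rw [re_inner_apply_self_eq_sum hS hn, ← (hS.eigenvectorBasis hn).sum_sq_norm_inner_right x,
      Finset.mul_sum]
    refine Finset.sum_le_sum fun j _ => ?_
    rcases le_or_gt j i with hj | hj
    · exact mul_le_mul_of_nonneg_right (hS.eigenvalues_antitone hn hj) (by positivity)
    · have := hfx j hj.ne'
      simp only [f, LinearMap.pi_apply, if_pos hj] at this
      have h0 : ⟪hS.eigenvectorBasis hn j, x⟫_ℂ = 0 := this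
      simp [h0]
  have h2 : (⟪T x, x⟫_ℂ).re ≤ hT.eigenvalues hn i * ‖x‖ ^ 2 := by
    rw [re_inner_apply_self_eq_sum hT hn, ← (hT.eigenvectorBasis hn).sum_sq_norm_inner_right x,
      Finset.mul_sum]
    refine Finset.sum_le_sum fun j _ => ?_
    rcases le_or_gt i j with hj | hj
    · exact mul_le_mul_of_nonneg_right (hT.eigenvalues_antitone hn hj) (by positivity)
    · have := hfx j hj.ne
      simp only [f, LinearMap.pi_apply, if_neg hj.not_gt] at this
      have h0 : ⟪hT.eigenvectorBasis hn j, x⟫_ℂ = 0 := this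
      simp [h0]
  have hpos : 0 < ‖x‖ ^ 2 := by positivity
  have := h x
  nlinarith

end Weyl

variable {ι : Type*} [Fintype ι] [DecidableEq ι]

theorem eigenvalues₀_le_add_norm {A B : Matrix ι ι ℂ} (hA : A.IsHermitian) (hB : B.IsHermitian)
    (i : Fin (Fintype.card ι)) : hA.eigenvalues₀ i ≤ hB.eigenvalues₀ i + ‖A - B‖ := by
  refine eigenvalues_le_add _ _ _ (fun x => ?_) i
  have h1 : Matrix.toEuclideanLin A x = Matrix.toEuclideanLin B x
      + Matrix.toEuclideanLin (A - B) x := by simp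
  rw [h1, inner_add_left, Complex.add_re]
  gcongr
  calc _ ≤ ‖⟪Matrix.toEuclideanLin (A - B) x, x⟫_ℂ‖ := Complex.re_le_norm _
    _ ≤ ‖Matrix.toEuclideanLin (A - B) x‖ * ‖x‖ := norm_inner_le_norm _ _
    _ ≤ (‖A - B‖ * ‖x‖) * ‖x‖ := by
      gcongr
      exact Matrix.l2_opNorm_mulVec (A - B) x
    _ = _ := by ring

theorem abs_eigenvalues₀_sub_le {A B : Matrix ι ι ℂ} (hA : A.IsHermitian) (hB : B.IsHermitian)
    (i : Fin (Fintype.card ι)) : |hA.eigenvalues₀ i - hB.eigenvalues₀ i| ≤ ‖A - B‖ := by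
  have h1 := eigenvalues₀_le_add_norm hA hB i
  have h2 := eigenvalues₀_le_add_norm hB hA i
  rw [norm_sub_rev] at h2
  rw [abs_le]
  constructor <;> linarith

/-- Weyl's inequality makes ordered eigenvalues 1-Lipschitz in operator norm. Measurability of the
levels in the disorder rests on this. -/
theorem continuous_eigenvalues₀ {X : Type*} [TopologicalSpace X] {F : X → Matrix ι ι ℂ}
    (hF : ∀ x, (F x).IsHermitian) (hc : Continuous F) (i : Fin (Fintype.card ι)) :
    Continuous fun x => (hF x).eigenvalues₀ i := by
  rw [continuous_iff_continuousAt]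
  intro x
  rw [ContinuousAt, tendsto_iff_norm_sub_tendsto_zero]
  refine squeeze_zero (fun _ => norm_nonneg _) (fun y => abs_eigenvalues₀_sub_le (hF y) (hF x) i) ?_
  rw [← tendsto_iff_norm_sub_tendsto_zero]
  exact hc.tendsto x

/-- If a Hermitian matrix is unitarily equivalent to `diagonal d`, its eigenvalues are `d`. -/
theorem map_eigenvalues₀_eq {A V : Matrix ι ι ℂ} (hA : A.IsHermitian)
    (hV : V * star V = 1) (d : ι → ℝ)
    (h : A = V * Matrix.diagonal (fun i => (d i : ℂ)) * star V) :
    Finset.univ.val.map hA.eigenvalues₀ = Finset.univ.val.map d := by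
  have hV' : star V * V = 1 := mul_eq_one_comm.1 hV
  have h1 : A.charpoly = (Matrix.diagonal (fun i => (d i : ℂ))).charpoly := by
    rw [h, Matrix.charpoly_mul_comm, ← mul_assoc, hV', one_mul]
  have h2 := hA.roots_charpoly_eq_eigenvalues₀
  have h4 : ∏ i, (Polynomial.X - Polynomial.C (d i : ℂ))
      = ((Finset.univ.val.map fun i => (d i : ℂ)).map fun a => Polynomial.X - Polynomial.C a).prod := by
    rw [Multiset.map_map]; rfl
  rw [h1, Matrix.charpoly_diagonal, h4, Polynomial.roots_multiset_prod_X_sub_C] at h2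
  have h3 := congrArg (Multiset.map Complex.re) h2
  simpa [Multiset.map_map, Function.comp_def] using h3.symm

/-! ### The determinant of the Kronecker sum, and its growth in a complex coupling. -/

/-- The Kronecker sum `A ⊗ 1 + 1 ⊗ A`. -/
def kronSum (A : Matrix ι ι ℂ) : Matrix (ι × ι) (ι × ι) ℂ := A ⊗ₖ 1 + 1 ⊗ₖ A

omit [Fintype ι] in
theorem kronSum_apply (A : Matrix ι ι ℂ) (p q : ι × ι) :
    kronSum A p q = A p.1 q.1 * (1 : Matrix ι ι ℂ) p.2 q.2
      + (1 : Matrix ι ι ℂ) p.1 q.1 * A p.2 q.2 := rfl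

theorem kronSum_conj {U A : Matrix ι ι ℂ} (hU : U * star U = 1) :
    kronSum (U * A * star U) = (U ⊗ₖ U) * kronSum A * (star U ⊗ₖ star U) := by
  simp only [kronSum, mul_add, add_mul, ← Matrix.mul_kronecker_mul, mul_one, hU]

theorem det_kronSum_conj {U A : Matrix ι ι ℂ} (hU : U * star U = 1) :
    (kronSum (U * A * star U)).det = (kronSum A).det := by
  rw [kronSum_conj hU, Matrix.det_mul, Matrix.det_mul, mul_right_comm, ← Matrix.det_mul,
    ← Matrix.mul_kronecker_mul, hU, Matrix.one_kronecker_one, Matrix.det_one, one_mul]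

omit [Fintype ι] in
theorem kronSum_diagonal (d : ι → ℂ) :
    kronSum (Matrix.diagonal d) = Matrix.diagonal fun p : ι × ι => d p.1 + d p.2 := by
  rw [kronSum, ← Matrix.diagonal_one, Matrix.diagonal_kronecker_diagonal,
    Matrix.diagonal_kronecker_diagonal, Matrix.diagonal_add]
  simp

theorem eq_eigenvectorUnitary_conj {A : Matrix ι ι ℂ} (hA : A.IsHermitian) :
    A = (hA.eigenvectorUnitary : Matrix ι ι ℂ)
      * Matrix.diagonal (fun i => (hA.eigenvalues i : ℂ))
      * star (hA.eigenvectorUnitary : Matrix ι ι ℂ) := by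
  have := hA.spectral_theorem
  rwa [Unitary.conjStarAlgAut_apply] at this

/-- In an eigenbasis of A the Kronecker sum is diagonal with the pair sums as entries. Products of
pair sums thus become polynomials in the matrix entries. -/
theorem det_kronSum {A : Matrix ι ι ℂ} (hA : A.IsHermitian) :
    (kronSum A).det = ∏ p : ι × ι, ((hA.eigenvalues p.1 + hA.eigenvalues p.2 : ℝ) : ℂ) := by
  conv_lhs => rw [eq_eigenvectorUnitary_conj hA]
  rw [det_kronSum_conj (Unitary.coe_mul_star_self _), kronSum_diagonal, Matrix.det_diagonal]
  simp

/-- Expanding the product of column sums gives one nonnegative term per map κ → κ; the Leibniz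
formula only uses the permutations. -/
theorem norm_det_le_prod_sum {κ : Type*} [Fintype κ] [DecidableEq κ] (M : Matrix κ κ ℂ) :
    ‖M.det‖ ≤ ∏ i, ∑ j, ‖M j i‖ := by
  rw [Matrix.det_apply, Finset.prod_univ_sum]
  calc _ ≤ ∑ σ : Equiv.Perm κ, ∏ i, ‖M (σ i) i‖ := by
        refine (norm_sum_le _ _).trans (Finset.sum_le_sum fun σ _ => ?_)
        rw [Units.smul_def, zsmul_eq_mul, norm_mul, norm_prod]
        rcases Int.units_eq_one_or (Equiv.Perm.sign σ) with h | h <;> simp [h]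
    _ = ∑ f ∈ Finset.univ.image (fun σ : Equiv.Perm κ => (σ : κ → κ)), ∏ i, ‖M (f i) i‖ := by
        rw [Finset.sum_image]
        exact fun a _ b _ hab => Equiv.coe_fn_injective hab
    _ ≤ _ := by
        refine Finset.sum_le_sum_of_subset_of_nonneg ?_ fun _ _ _ => by positivity
        intro f _
        simp

/-- In the eigenbasis of A the perturbation is z times the Kronecker sum of a unitary matrix, whose
entries have modulus at most 2. Each column sum therefore grows by at most 2|ι|²‖z‖. Complex z, for
which A + zB need not be Hermitian, is needed for Jensen's inequality. -/
theorem norm_det_kronSum_add_le {A B : Matrix ι ι ℂ} (hA : A.IsHermitian)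
    (hB : B ∈ Matrix.unitaryGroup ι ℂ) (z : ℂ) :
    ‖(kronSum (A + z • B)).det‖ ≤ ∏ p : ι × ι,
      (|hA.eigenvalues p.1 + hA.eigenvalues p.2| + 2 * (Fintype.card ι) ^ 2 * ‖z‖) := by
  set U : Matrix ι ι ℂ := (hA.eigenvectorUnitary : Matrix ι ι ℂ) with hU
  have hUU : U * star U = 1 := Unitary.coe_mul_star_self _
  set W : Matrix ι ι ℂ := star U * B * U with hW
  have hWu : W ∈ Matrix.unitaryGroup ι ℂ :=
    mul_mem (mul_mem (Unitary.star_mem hA.eigenvectorUnitary.2) hB) hA.eigenvectorUnitary.2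
  have hAB : A + z • B = U * (Matrix.diagonal (fun i => (hA.eigenvalues i : ℂ)) + z • W)
      * star U := by
    rw [mul_add, add_mul, ← eq_eigenvectorUnitary_conj hA, mul_smul_comm, smul_mul_assoc, hW]
    congr 2
    calc B = (U * star U) * B * (U * star U) := by rw [hUU, one_mul, mul_one]
      _ = _ := by simp only [mul_assoc]
  have hks : kronSum (Matrix.diagonal (fun i => (hA.eigenvalues i : ℂ)) + z • W)
      = Matrix.diagonal (fun p : ι × ι => ((hA.eigenvalues p.1 + hA.eigenvalues p.2 : ℝ) : ℂ))
        + z • kronSum W := by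
    have := kronSum_diagonal (fun i => (hA.eigenvalues i : ℂ))
    simp only [kronSum, Matrix.add_kronecker, Matrix.kronecker_add, Matrix.smul_kronecker,
      Matrix.kronecker_smul, smul_add] at this ⊢
    push_cast
    rw [← this]
    abel
  rw [hAB, det_kronSum_conj hUU, hks]
  refine (norm_det_le_prod_sum _).trans (Finset.prod_le_prod (fun _ _ => by positivity) ?_)
  intro p _
  have hent (q : ι × ι) : ‖kronSum W q p‖ ≤ 2 := by
    have h1 (b : Prop) [Decidable b] : ‖(if b then 1 else 0 : ℂ)‖ ≤ 1 := by split_ifs <;> simp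
    rw [kronSum, Matrix.add_apply, Matrix.kronecker_apply, Matrix.kronecker_apply]
    refine (norm_add_le _ _).trans ?_
    rw [norm_mul, norm_mul, Matrix.one_apply, Matrix.one_apply]
    have := mul_le_one₀ (entry_norm_bound_of_unitary hWu q.1 p.1) (norm_nonneg _) (h1 (q.2 = p.2))
    have := mul_le_one₀ (h1 (q.1 = p.1)) (norm_nonneg _) (entry_norm_bound_of_unitary hWu q.2 p.2)
    linarith
  calc _ ≤ ∑ q, (‖Matrix.diagonal (fun p : ι × ι =>
          ((hA.eigenvalues p.1 + hA.eigenvalues p.2 : ℝ) : ℂ)) q p‖ + ‖z‖ * 2) := by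
        refine Finset.sum_le_sum fun q _ => ?_
        rw [Matrix.add_apply, Matrix.smul_apply, smul_eq_mul]
        refine (norm_add_le _ _).trans ?_
        rw [norm_mul]
        gcongr
        exact hent q
    _ = _ := by
        rw [Finset.sum_add_distrib, Finset.sum_eq_single p]
        · simp only [Matrix.diagonal_apply_eq, Complex.norm_real, Real.norm_eq_abs,
            Finset.sum_const, Finset.card_univ, Fintype.card_prod, nsmul_eq_mul]
          push_cast
          ring
        · intro q _ hq
          simp [Matrix.diagonal_apply_ne _ hq]
        · simp

/-- The polynomial `z ↦ det ((A + z B) ⊗ 1 + 1 ⊗ (A + z B))`. -/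
def kronPoly (A B : Matrix ι ι ℂ) : Polynomial ℂ :=
  ((Polynomial.X : Polynomial ℂ) • (kronSum B).map Polynomial.C
    + (kronSum A).map Polynomial.C).det

theorem eval_kronPoly (A B : Matrix ι ι ℂ) (z : ℂ) :
    (kronPoly A B).eval z = (kronSum (A + z • B)).det := by
  rw [kronPoly, ← Polynomial.coe_evalRingHom, RingHom.map_det]
  congr 1
  ext p q
  simp only [RingHom.mapMatrix_apply, Matrix.map_apply, Matrix.add_apply, Matrix.smul_apply,
    smul_eq_mul, Polynomial.coe_evalRingHom, Polynomial.eval_add, Polynomial.eval_mul,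
    Polynomial.eval_X, Polynomial.eval_C, kronSum_apply]
  ring

theorem natDegree_kronPoly_le (A B : Matrix ι ι ℂ) :
    (kronPoly A B).natDegree ≤ (Fintype.card ι) ^ 2 := by
  refine (Polynomial.natDegree_det_X_add_C_le _ _).trans ?_
  rw [Fintype.card_prod, sq]

end QuantumSun

end

/-! ### Jensen's inequality and the mean of log|p| over [-1/2, 1/2]. -/

noncomputable section

namespace QuantumSun

open Polynomial ComplexConjugate

/-- Jensen's inequality: a function that is small on a circle and not small at the centre has few
zeros in a smaller disc. -/
theorem norm_mul_prod_mul_pow_le {R R' M : ℝ} (hR : 0 < R) (hR' : R < R') (s : Multiset ℂ)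
    (hs : ∀ a ∈ s, ‖a‖ < R) (f : ℂ → ℂ) (hf : Differentiable ℂ f)
    (hM : ∀ z : ℂ, ‖z‖ = R' → ‖f z * (s.map fun a => z - a).prod‖ ≤ M) :
    ‖f 0‖ * (s.map fun a => ‖a‖).prod * (R' / R) ^ s.card ≤ M := by
  have hR'0 : 0 < R' := hR.trans hR'
  induction s using Multiset.induction_on generalizing f with
  | empty =>
    simp only [Multiset.map_zero, Multiset.prod_zero, mul_one, Multiset.card_zero, pow_zero]
    refine Complex.norm_le_of_forall_mem_frontier_norm_le (U := Metric.ball (0 : ℂ) R')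
      Metric.isBounded_ball hf.diffContOnCl (fun z hz => ?_)
      (subset_closure (Metric.mem_ball_self hR'0))
    rw [frontier_ball _ hR'0.ne', mem_sphere_zero_iff_norm] at hz
    simpa using hM z hz
  | cons a s ih =>
    -- The factor z - a is traded for (R'² - conj a · z)/R', which has the same modulus on |z| = R',
    -- and is absorbed into f. At 0 its modulus is R' instead of ‖a‖, a gain of at least R'/R.
    have key := ih (fun b hb => hs b (Multiset.mem_cons_of_mem hb))
      (fun z => f z * ((R' ^ 2 - conj a * z) / R'))
      (by fun_prop) (fun z hz => by
        refine le_of_eq_of_le ?_ (hM z hz)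
        rw [Multiset.map_cons, Multiset.prod_cons, ← mul_assoc, norm_mul, norm_mul, norm_mul,
          norm_mul, norm_div]
        congr 2
        have h1 : ((R' : ℂ) ^ 2 - conj a * z) = z * conj (z - a) := by
          rw [map_sub, mul_sub, Complex.mul_conj, Complex.normSq_eq_norm_sq, hz]
          push_cast
          ring
        rw [h1, norm_mul, Complex.norm_conj, hz, Complex.norm_real, Real.norm_of_nonneg hR'0.le]
        field_simp)
    refine le_trans ?_ key
    have ha := hs a (Multiset.mem_cons_self a s)
    have h2 : ‖((R' : ℂ) ^ 2 - conj a * 0) / R'‖ = R' := by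
      rw [mul_zero, sub_zero, sq, mul_div_assoc, div_self (by exact_mod_cast hR'0.ne'), mul_one,
        Complex.norm_real, Real.norm_of_nonneg hR'0.le]
    rw [Multiset.map_cons, Multiset.prod_cons, Multiset.card_cons, pow_succ, norm_mul, h2]
    have h3 : ‖a‖ * (R' / R) ≤ R' := by
      rw [mul_div_assoc', div_le_iff₀ hR, mul_comm R']
      gcongr
    have h4 : 0 ≤ (s.map fun a => ‖a‖).prod := Multiset.prod_nonneg (by simp)
    calc _ = ‖f 0‖ * (s.map fun a => ‖a‖).prod * (R' / R) ^ s.card * (‖a‖ * (R' / R)) := by ring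
      _ ≤ ‖f 0‖ * (s.map fun a => ‖a‖).prod * (R' / R) ^ s.card * R' := by
        gcongr
      _ = _ := by ring

/-- With the primitive t log t - t, each boundary term is at least -1, because t log t ≥ -1 for t ≥
-1, and the linear part gives -1. `Real.log` means log|t|, so the singularity may lie inside the
interval. -/
theorem neg_three_le_integral_log (x : ℝ) (hx : |x| ≤ 1) :
    -3 ≤ ∫ g in (-1 / 2 : ℝ)..1 / 2, Real.log (g - x) := by
  rw [intervalIntegral.integral_comp_sub_right (fun t => Real.log t), integral_log]
  have key (t : ℝ) (ht : -1 ≤ t) : -1 ≤ t * Real.log t := by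
    rcases lt_or_ge 0 t with h | h
    · have h1 := mul_le_mul_of_nonneg_left (Real.one_sub_inv_le_log_of_pos h) h.le
      rw [mul_sub, mul_inv_cancel₀ h.ne'] at h1
      linarith
    · have h1 : Real.log t ≤ 0 := by
        rw [← Real.log_neg_eq_log]
        exact Real.log_nonpos (by linarith) (by linarith)
      nlinarith
  have hx' := abs_le.1 hx
  have h1 := key (1 / 2 - x) (by linarith)
  have h2 := key (-(-1 / 2 - x)) (by linarith)
  rw [Real.log_neg_eq_log] at h2
  linarith

theorem intervalIntegrable_log_norm_eval (p : ℂ[X]) (a b : ℝ) :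
    IntervalIntegrable (fun g : ℝ => Real.log ‖p.eval (g : ℂ)‖) volume a b := by
  have h : MeromorphicOn (fun g : ℝ => p.eval (g : ℂ)) (Set.uIcc a b) := by
    intro x _
    apply AnalyticAt.meromorphicAt
    have h1 : AnalyticAt ℝ (fun g : ℝ => (g : ℂ)) x := Complex.ofRealCLM.analyticAt x
    have h2 : AnalyticAt ℝ (fun z : ℂ => p.eval z) (x : ℂ) :=
      (AnalyticOnNhd.eval_polynomial (𝕜 := ℂ) p (x : ℂ) trivial).restrictScalars (𝕜 := ℝ)
    exact h2.comp h1
  exact MeromorphicOn.intervalIntegrable_log_norm h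

theorem intervalIntegrable_log_norm_one_sub (a : ℂ) :
    IntervalIntegrable (fun g : ℝ => Real.log ‖1 - (g : ℂ) / a‖) volume (-1 / 2) (1 / 2) := by
  have := intervalIntegrable_log_norm_eval (1 - X * C (a⁻¹)) (-1 / 2) (1 / 2)
  simpa only [div_eq_mul_inv, eval_sub, eval_one, eval_mul, eval_X, eval_C] using this

/-- If ‖a‖ < 1, then |1 - g/a| ≥ |g - Re a| and the logarithmic singularity costs at most 3. If ‖a‖
≥ 1, then u = |g/a| ≤ 1/2 and log(1 - u) ≥ -2u gives the pointwise bound -1/‖a‖. -/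
theorem neg_le_integral_log_norm_one_sub {R : ℝ} (hR : 1 ≤ R) {a : ℂ} (ha : a ≠ 0) :
    -(if ‖a‖ < R then 3 else 1 / R)
      ≤ ∫ g in (-1 / 2 : ℝ)..1 / 2, Real.log ‖1 - (g : ℂ) / a‖ := by
  have hint := intervalIntegrable_log_norm_one_sub a
  have hna : 0 < ‖a‖ := norm_pos_iff.2 ha
  rcases lt_or_ge ‖a‖ 1 with h1 | h1
  · rw [if_pos (h1.trans_le hR)]
    refine (neg_three_le_integral_log a.re ((Complex.abs_re_le_norm a).trans h1.le)).trans ?_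
    refine intervalIntegral.integral_mono_ae_restrict (by norm_num) ?_ hint ?_
    · have := (intervalIntegral.intervalIntegrable_log' (a := -1 / 2 - a.re)
        (b := 1 / 2 - a.re)).comp_sub_right a.re
      simpa using this
    · refine ae_restrict_of_ae ?_
      have : ∀ᵐ g : ℝ, g ≠ a.re := by simp [ae_iff]
      filter_upwards [this] with g hg
      rw [← Real.log_abs]
      refine Real.log_le_log (abs_pos.2 (sub_ne_zero.2 hg)) ?_
      have h2 : 1 - (g : ℂ) / a = (a - g) / a := by field_simp
      rw [h2, norm_div, le_div_iff₀ hna]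
      calc |g - a.re| * ‖a‖ ≤ |g - a.re| * 1 := by gcongr
        _ = |(a - g).re| := by simp [abs_sub_comm]
        _ ≤ _ := Complex.abs_re_le_norm _
  · have h3 : ∀ g ∈ Set.Icc (-1 / 2 : ℝ) (1 / 2), -(1 / ‖a‖) ≤ Real.log ‖1 - (g : ℂ) / a‖ := by
      intro g hg
      have hg' : |g| ≤ 1 / 2 := abs_le.2 ⟨by linarith [hg.1], hg.2⟩
      set u := |g| / ‖a‖ with hu
      have hu1 : u ≤ 1 / 2 / ‖a‖ := by rw [hu]; gcongr
      have hu2 : 1 / 2 / ‖a‖ ≤ 1 / 2 := div_le_self (by norm_num) h1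
      have hu0 : 0 ≤ u := by positivity
      have h4 : 1 - u ≤ ‖1 - (g : ℂ) / a‖ := by
        have := norm_sub_norm_le (1 : ℂ) ((g : ℂ) / a)
        simpa [hu] using this
      have h5 : 0 < 1 - u := by linarith
      calc -(1 / ‖a‖) = - (2 * (1 / 2 / ‖a‖)) := by ring
        _ ≤ -(2 * u) := by gcongr
        _ ≤ 1 - (1 - u)⁻¹ := by
          rw [← sub_nonneg]
          have : 1 - (1 - u)⁻¹ - -(2 * u) = u * (1 - 2 * u) * (1 - u)⁻¹ := by
            field_simp; ring
          rw [this]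
          have : 0 ≤ 1 - 2 * u := by linarith
          positivity
        _ ≤ Real.log (1 - u) := Real.one_sub_inv_le_log_of_pos h5
        _ ≤ _ := Real.log_le_log h5 h4
    have h6 : -(1 / ‖a‖) ≤ ∫ g in (-1 / 2 : ℝ)..1 / 2, Real.log ‖1 - (g : ℂ) / a‖ := by
      have := intervalIntegral.integral_mono_on (μ := volume) (by norm_num : (-1 / 2 : ℝ) ≤ 1 / 2)
        (intervalIntegrable_const (c := -(1 / ‖a‖))) hint h3
      rw [intervalIntegral.integral_const] at this
      norm_num at this ⊢
      exact this
    refine le_trans ?_ h6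
    split_ifs with h7
    · have : 1 / ‖a‖ ≤ 1 := by rw [div_le_one hna]; exact h1
      linarith
    · have : 1 / ‖a‖ ≤ 1 / R := one_div_le_one_div_of_le (by linarith) (not_lt.1 h7)
      linarith

theorem log_norm_multiset_prod {s : Multiset ℂ} (hs : (0 : ℂ) ∉ s) :
    Real.log ‖s.prod‖ = (s.map fun a => Real.log ‖a‖).sum := by
  induction s using Multiset.induction_on with
  | empty => simp
  | cons a s ih =>
    rw [Multiset.mem_cons, not_or] at hs
    have h1 : s.prod ≠ 0 := Multiset.prod_ne_zero hs.2
    rw [Multiset.prod_cons, norm_mul, Real.log_mul (norm_ne_zero_iff.2 (Ne.symm hs.1))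
      (norm_ne_zero_iff.2 h1), ih hs.2, Multiset.map_cons, Multiset.sum_cons]

theorem ae_eval_ofReal_ne_zero {p : ℂ[X]} (hp : p ≠ 0) : ∀ᵐ g : ℝ, p.eval (g : ℂ) ≠ 0 := by
  have hfin : {g : ℝ | p.eval (g : ℂ) = 0}.Finite := by
    refine Set.Finite.preimage (f := fun g : ℝ => (g : ℂ)) (s := {z | p.eval z = 0})
      (Complex.ofReal_injective.injOn) ?_
    refine (p.roots.toFinset.finite_toSet).subset fun z hz => ?_
    simpa [hp] using hz
  exact measure_eq_zero_iff_ae_notMem.1 (hfin.measure_zero volume)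

theorem neg_sum_le_integral_sum {R : ℝ} (hR : 1 ≤ R) (s : Multiset ℂ) (hs : ∀ a ∈ s, a ≠ 0) :
    IntervalIntegrable (fun g : ℝ => (s.map fun a => Real.log ‖1 - (g : ℂ) / a‖).sum) volume
        (-1 / 2) (1 / 2) ∧
      -(s.map fun a => if ‖a‖ < R then (3 : ℝ) else 1 / R).sum
        ≤ ∫ g in (-1 / 2 : ℝ)..1 / 2, (s.map fun a => Real.log ‖1 - (g : ℂ) / a‖).sum := by
  induction s using Multiset.induction_on with
  | empty => simp
  | cons a s ih =>
    obtain ⟨h1, h2⟩ := ih fun b hb => hs b (Multiset.mem_cons_of_mem hb)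
    have ha := hs a (Multiset.mem_cons_self a s)
    have h3 := intervalIntegrable_log_norm_one_sub a
    have h4 := neg_le_integral_log_norm_one_sub hR ha
    simp only [Multiset.map_cons, Multiset.sum_cons]
    refine ⟨h3.add h1, ?_⟩
    rw [intervalIntegral.integral_add h3 h1]
    linarith

/-- The quantity p(g)/p(0) is the product of 1 - g/a over the roots a. Jensen's inequality, with the
far factors put into f, bounds the number of roots in |a| < R by T/log(R'/R), and each costs 3. The
others, at most d of them, cost 1/R each. -/
theorem log_norm_eval_zero_sub_integral_le {p : ℂ[X]} {d : ℕ} (hd : p.natDegree ≤ d)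
    (h0 : p.eval 0 ≠ 0) {R R' T : ℝ} (hR : 1 ≤ R) (hR' : R < R')
    (hT : ∀ z : ℂ, ‖z‖ = R' → ‖p.eval z‖ ≤ ‖p.eval 0‖ * Real.exp T) :
    Real.log ‖p.eval 0‖ - ∫ g in (-1 / 2 : ℝ)..1 / 2, Real.log ‖p.eval (g : ℂ)‖
      ≤ 3 * (T / Real.log (R' / R)) + d / R := by
  have hp : p ≠ 0 := by rintro rfl; simp at h0
  have hsplit : p = C p.leadingCoeff * (p.roots.map fun a => X - C a).prod :=
    (IsAlgClosed.splits p).eq_prod_roots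
  have heval (z : ℂ) : p.eval z = p.leadingCoeff * (p.roots.map fun a => z - a).prod := by
    conv_lhs => rw [hsplit]
    rw [eval_mul, eval_C, eval_multiset_prod, Multiset.map_map]
    simp
  have hroot (a : ℂ) (ha : a ∈ p.roots) : a ≠ 0 := by
    rintro rfl
    exact h0 ((mem_roots hp).1 ha)
  set s := p.roots.filter fun a => ‖a‖ < R with hs
  set t := p.roots.filter fun a => ¬ ‖a‖ < R with ht
  have hst : s + t = p.roots := Multiset.filter_add_not _ _
  have hlog : 0 < Real.log (R' / R) := Real.log_pos ((one_lt_div (by linarith)).2 hR')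
  have hcard : (s.card : ℝ) ≤ T / Real.log (R' / R) := by
    have key := norm_mul_prod_mul_pow_le (M := ‖p.eval 0‖ * Real.exp T) (by linarith) hR' s
      (fun a ha => (Multiset.mem_filter.1 ha).2)
      (fun z => p.leadingCoeff * (t.map fun a => z - a).prod)
      (by
        have : (fun z => p.leadingCoeff * (t.map fun a => z - a).prod)
            = fun z => (C p.leadingCoeff * (t.map fun a => X - C a).prod).eval z := by
          ext z
          rw [eval_mul, eval_C, eval_multiset_prod, Multiset.map_map]
          simp
        rw [this]
        exact Polynomial.differentiable _)
      (fun z hz => by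
        rw [mul_assoc, ← Multiset.prod_add, ← Multiset.map_add, add_comm t, hst, ← heval]
        exact hT z hz)
    have h1 : ‖p.leadingCoeff * (t.map fun a => 0 - a).prod‖ * (s.map fun a => ‖a‖).prod
        = ‖p.eval 0‖ := by
      have : (s.map fun a => ‖a‖).prod = ‖(s.map fun a => 0 - a).prod‖ := by
        have h := map_multiset_prod (normHom : ℂ →*₀ ℝ) (s.map fun a => 0 - a)
        rw [Multiset.map_map] at h
        refine Eq.trans ?_ h.symm
        congr 1
        refine Multiset.map_congr rfl fun a _ => ?_
        simp
      rw [this, ← norm_mul, mul_assoc, ← Multiset.prod_add, ← Multiset.map_add, add_comm t, hst,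
        ← heval]
    rw [h1] at key
    have h2 : (R' / R) ^ s.card ≤ Real.exp T :=
      le_of_mul_le_mul_left key (norm_pos_iff.2 h0)
    rw [le_div_iff₀ hlog, ← Real.log_pow]
    have : 0 < R' / R := div_pos (by linarith) (by linarith)
    exact (Real.log_le_iff_le_exp (by positivity)).2 h2
  have hae : ∀ᵐ g : ℝ, Real.log ‖p.eval (g : ℂ)‖
      = Real.log ‖p.eval 0‖ + (p.roots.map fun a => Real.log ‖1 - (g : ℂ) / a‖).sum := by
    filter_upwards [ae_eval_ofReal_ne_zero hp] with g hg
    have h1 : p.eval (g : ℂ) = p.eval 0 * (p.roots.map fun a => 1 - (g : ℂ) / a).prod := by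
      rw [heval, heval 0, mul_assoc, ← Multiset.prod_map_mul]
      congr 2
      refine Multiset.map_congr rfl fun a ha => ?_
      have := hroot a ha
      field_simp
      ring
    have h2 := hg
    rw [h1] at h2
    rw [h1, norm_mul, Real.log_mul (norm_ne_zero_iff.2 h0)
      (norm_ne_zero_iff.2 (right_ne_zero_of_mul h2)),
      log_norm_multiset_prod fun h => right_ne_zero_of_mul h2 (Multiset.prod_eq_zero h),
      Multiset.map_map]
    rfl
  have hsum := neg_sum_le_integral_sum hR p.roots hroot
  rw [intervalIntegral.integral_congr_ae (hae.mono fun g hg _ => hg),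
    intervalIntegral.integral_add intervalIntegrable_const hsum.1,
    intervalIntegral.integral_const]
  have h3 : (p.roots.map fun a => if ‖a‖ < R then (3 : ℝ) else 1 / R).sum
      = 3 * s.card + t.card / R := by
    rw [← hst, Multiset.map_add, Multiset.sum_add,
      Multiset.map_congr rfl (fun a ha => if_pos (Multiset.mem_filter.1 ha).2),
      Multiset.map_congr rfl (fun a ha => if_neg (Multiset.mem_filter.1 ha).2)]
    simp only [Multiset.map_const', Multiset.sum_replicate, nsmul_eq_mul]
    ring
  have h4 : (t.card : ℝ) / R ≤ d / R := by
    have : t.card ≤ d := (Multiset.card_le_card (Multiset.filter_le _ _)).trans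
      ((card_roots' p).trans hd)
    gcongr
  have h5 := hsum.2
  rw [h3] at h5
  norm_num at h5 ⊢
  linarith

end QuantumSun

end

/-! ### The logarithmic weight of anti-resonances under a random perturbation. -/

noncomputable section

namespace QuantumSun

open scoped Matrix.Norms.L2Operator ENNReal

/-- The logarithmic weight `log (1 / |s|)` of an anti-resonance `|s| < ε`. -/
def logWeight (ε s : ℝ) : ℝ≥0∞ :=
  if |s| < ε then if s = 0 then ⊤ else ENNReal.ofReal (-Real.log |s|) else 0

/-- The total logarithmic weight of the anti-resonant pairs of a family of levels. -/
def potential {κ : Type*} [Fintype κ] (ε : ℝ) (a : κ → ℝ) : ℝ≥0∞ :=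
  ∑ q : κ × κ, logWeight ε (a q.1 + a q.2)

/-- The anti-resonant pairs of a family of levels. -/
def resonantPairs {κ : Type*} [Fintype κ] (ε : ℝ) (a : κ → ℝ) : Finset (κ × κ) :=
  Finset.univ.filter fun q => |a q.1 + a q.2| < ε

theorem measurable_logWeight (ε : ℝ) : Measurable (logWeight ε) := by
  refine Measurable.ite ?_ (Measurable.ite (measurableSet_singleton 0) measurable_const ?_)
    measurable_const
  · exact measurableSet_lt measurable_norm measurable_const
  · exact (Real.measurable_log.comp measurable_norm).neg.ennreal_ofReal

section Potential

variable {κ : Type*} [Fintype κ] {ε : ℝ} {a : κ → ℝ}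

theorem add_ne_zero_of_potential_ne_top (hε : 0 < ε) (h : potential ε a ≠ ⊤) (q : κ × κ) :
    a q.1 + a q.2 ≠ 0 := by
  intro h0
  apply h
  rw [potential, ENNReal.sum_eq_top]
  exact ⟨q, Finset.mem_univ q, by simp [logWeight, h0, hε]⟩

theorem potential_eq_ofReal (hε1 : ε ≤ 1) (h : ∀ q : κ × κ, a q.1 + a q.2 ≠ 0) :
    potential ε a = ENNReal.ofReal (∑ q ∈ resonantPairs ε a, -Real.log |a q.1 + a q.2|) := by
  rw [ENNReal.ofReal_sum_of_nonneg, resonantPairs, Finset.sum_filter, potential]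
  · simp [logWeight, h]
  · intro q hq
    have : |a q.1 + a q.2| < ε := by simpa [resonantPairs] using hq
    linarith [Real.log_nonpos (abs_nonneg (a q.1 + a q.2)) (by linarith)]

/-- Chebyshev's inequality for the weight: each anti-resonant pair contributes at least log(1/ε). -/
theorem card_resonantPairs_mul_le :
    ((resonantPairs ε a).card : ℝ≥0∞) * ENNReal.ofReal (-Real.log ε) ≤ potential ε a := by
  rw [potential, ← nsmul_eq_mul, ← Finset.sum_const]
  refine le_trans (Finset.sum_le_sum fun q hq => ?_)
    (Finset.sum_le_sum_of_subset (Finset.subset_univ (resonantPairs ε a)))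
  have hq' : |a q.1 + a q.2| < ε := by simpa [resonantPairs] using hq
  rw [logWeight, if_pos hq']
  split_ifs with h0
  · exact le_top
  · exact ENNReal.ofReal_le_ofReal
      (neg_le_neg (Real.log_le_log (abs_pos.2 h0) hq'.le))

end Potential

variable {ι : Type*} [Fintype ι] [DecidableEq ι]

theorem norm_det_kronSum {A : Matrix ι ι ℂ} (hA : A.IsHermitian) :
    ‖(kronSum A).det‖ = ∏ q : Fin (Fintype.card ι) × Fin (Fintype.card ι),
      |hA.eigenvalues₀ q.1 + hA.eigenvalues₀ q.2| := by
  rw [det_kronSum hA, norm_prod]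
  let e : ι ≃ Fin (Fintype.card ι) := (Fintype.equivOfCardEq (Fintype.card_fin _)).symm
  refine Fintype.prod_equiv (e.prodCongr e) _ _ fun p => ?_
  rw [Complex.norm_real]
  rfl

theorem norm_det_kronSum_add_le' {A B : Matrix ι ι ℂ} (hA : A.IsHermitian)
    (hB : B ∈ Matrix.unitaryGroup ι ℂ) (z : ℂ) :
    ‖(kronSum (A + z • B)).det‖ ≤ ∏ q : Fin (Fintype.card ι) × Fin (Fintype.card ι),
      (|hA.eigenvalues₀ q.1 + hA.eigenvalues₀ q.2| + 2 * (Fintype.card ι) ^ 2 * ‖z‖) := by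
  refine (norm_det_kronSum_add_le hA hB z).trans_eq ?_
  let e : ι ≃ Fin (Fintype.card ι) := (Fintype.equivOfCardEq (Fintype.card_fin _)).symm
  exact Fintype.prod_equiv (e.prodCongr e) _ _ fun p => rfl

theorem abs_eigenvalues₀_add_smul_sub_le [Nonempty ι] {A W : Matrix ι ι ℂ} (hA : A.IsHermitian)
    (hW : W ∈ Matrix.unitaryGroup ι ℂ) {β g : ℝ} (hβ : 0 ≤ β) (hg : |g| ≤ 1 / 2)
    (hc : (A + ((β * g : ℝ) : ℂ) • W).IsHermitian) (i : Fin (Fintype.card ι)) :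
    |hc.eigenvalues₀ i - hA.eigenvalues₀ i| ≤ β / 2 := by
  refine (abs_eigenvalues₀_sub_le hc hA i).trans ?_
  rw [add_sub_cancel_left, norm_smul, Complex.norm_real, Real.norm_eq_abs, abs_mul,
    abs_of_nonneg hβ, CStarRing.norm_of_mem_unitary hW]
  nlinarith

section Step

variable [Nonempty ι] {A W : Matrix ι ι ℂ} (hA : A.IsHermitian)
  (hW : W ∈ Matrix.unitaryGroup ι ℂ) {β ε ε' : ℝ} (hβ : 0 ≤ β) (hεε : ε' + β ≤ ε)
  (hc : ∀ g : ℝ, (A + ((β * g : ℝ) : ℂ) • W).IsHermitian)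

include hA hW hβ

theorem abs_pair_sub_le {g : ℝ} (hg : |g| ≤ 1 / 2)
    (q : Fin (Fintype.card ι) × Fin (Fintype.card ι)) :
    |((hc g).eigenvalues₀ q.1 + (hc g).eigenvalues₀ q.2)
      - (hA.eigenvalues₀ q.1 + hA.eigenvalues₀ q.2)| ≤ β := by
  have h1 := abs_eigenvalues₀_add_smul_sub_le hA hW hβ hg (hc g) q.1
  have h2 := abs_eigenvalues₀_add_smul_sub_le hA hW hβ hg (hc g) q.2
  rw [abs_le] at h1 h2 ⊢
  constructor <;> linarith

include hεε

/-- By Weyl's inequality a pair sum moves by at most β. Lowering the threshold by β or more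
therefore admits no new pair. -/
theorem resonantPairs_add_smul_subset {g : ℝ} (hg : |g| ≤ 1 / 2) :
    resonantPairs ε' (hc g).eigenvalues₀ ⊆ resonantPairs ε hA.eigenvalues₀ := by
  intro q hq
  have h1 := abs_pair_sub_le hA hW hβ hc hg q
  simp only [resonantPairs, Finset.mem_filter, Finset.mem_univ, true_and] at hq ⊢
  rw [abs_lt] at hq ⊢
  rw [abs_le] at h1
  constructor <;> linarith

/-- Split log|det| into the pairs Z resonant before the perturbation and the rest. A non-resonant
sum is at least ε and moves by at most β, so its logarithm grows by at most β/ε, in total at most 1.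
A gain of weight on Z is thus paid for by a drop of log|det|, and Z contains all pairs resonant
afterwards. -/
theorem potential_add_smul_le {g : ℝ} (hg : |g| ≤ 1 / 2) (hε : 0 < ε) (hεβ : ε + β ≤ 1)
    (hM : (Fintype.card ι : ℝ) ^ 2 * (β / ε) ≤ 1)
    (h0 : ∀ q : Fin (Fintype.card ι) × Fin (Fintype.card ι),
      hA.eigenvalues₀ q.1 + hA.eigenvalues₀ q.2 ≠ 0)
    (hg0 : (kronSum (A + ((β * g : ℝ) : ℂ) • W)).det ≠ 0) :
    ∃ F : ℝ, 0 ≤ F ∧ potential ε' (hc g).eigenvalues₀ ≤ ENNReal.ofReal F ∧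
      F ≤ Real.log ‖(kronSum A).det‖ - Real.log ‖(kronSum (A + ((β * g : ℝ) : ℂ) • W)).det‖
        + ∑ q ∈ resonantPairs ε hA.eigenvalues₀,
            -Real.log |hA.eigenvalues₀ q.1 + hA.eigenvalues₀ q.2| + 1 := by
  set a := hA.eigenvalues₀ with ha
  set c := (hc g).eigenvalues₀ with hcdef
  set Z := resonantPairs ε a with hZ
  have hca (q : Fin (Fintype.card ι) × Fin (Fintype.card ι)) :
      |c q.1 + c q.2| ≤ |a q.1 + a q.2| + β := by
    have := abs_pair_sub_le hA hW hβ hc hg q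
    have h2 := abs_sub_abs_le_abs_sub (c q.1 + c q.2) (a q.1 + a q.2)
    linarith
  have hdet := norm_det_kronSum (hc g)
  have hc0 (q : Fin (Fintype.card ι) × Fin (Fintype.card ι)) : c q.1 + c q.2 ≠ 0 := by
    intro h
    apply hg0
    rw [← norm_eq_zero, hdet]
    exact Finset.prod_eq_zero (Finset.mem_univ q) (abs_eq_zero.2 h)
  have hmemZ {q : Fin (Fintype.card ι) × Fin (Fintype.card ι)} :
      q ∈ Z ↔ |a q.1 + a q.2| < ε := by simp [hZ, resonantPairs]
  have hnn (q) (hq : q ∈ Z) : 0 ≤ -Real.log |c q.1 + c q.2| := by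
    have := hca q
    have := hmemZ.1 hq
    linarith [Real.log_nonpos (abs_nonneg (c q.1 + c q.2)) (by linarith)]
  refine ⟨∑ q ∈ Z, -Real.log |c q.1 + c q.2|, Finset.sum_nonneg hnn, ?_, ?_⟩
  · rw [potential_eq_ofReal (by linarith) hc0]
    refine ENNReal.ofReal_le_ofReal (Finset.sum_le_sum_of_subset_of_nonneg
      (resonantPairs_add_smul_subset hA hW hβ hεε hc hg) fun q hq _ => hnn q hq)
  · have hsplit (f : Fin (Fintype.card ι) → ℝ) (hf : ∀ q : _ × _, f q.1 + f q.2 ≠ 0) :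
        Real.log (∏ q : _ × _, |f q.1 + f q.2|) + ∑ q ∈ Z, -Real.log |f q.1 + f q.2|
          = ∑ q ∈ Zᶜ, Real.log |f q.1 + f q.2| := by
      rw [Real.log_prod (fun q _ => abs_ne_zero.2 (hf q)), Finset.sum_neg_distrib,
        ← Finset.sum_add_sum_compl Z]
      ring
    have h1 := hsplit a h0
    have h2 := hsplit c hc0
    rw [← norm_det_kronSum hA] at h1
    rw [← hdet] at h2
    have h3 : ∑ q ∈ Zᶜ, Real.log |c q.1 + c q.2|
        ≤ ∑ q ∈ Zᶜ, (Real.log |a q.1 + a q.2| + β / ε) := by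
      refine Finset.sum_le_sum fun q hq => ?_
      have hq' : ε ≤ |a q.1 + a q.2| := by
        rw [Finset.mem_compl, hmemZ, not_lt] at hq
        exact hq
      have hpos : 0 < |a q.1 + a q.2| := hε.trans_le hq'
      have h4 : |c q.1 + c q.2| ≤ |a q.1 + a q.2| * Real.exp (β / ε) := by
        calc |c q.1 + c q.2| ≤ |a q.1 + a q.2| + β := hca q
          _ = |a q.1 + a q.2| + ε * (β / ε) := by field_simp
          _ ≤ |a q.1 + a q.2| + |a q.1 + a q.2| * (β / ε) := by gcongr
          _ = |a q.1 + a q.2| * (β / ε + 1) := by ring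
          _ ≤ _ := by
            gcongr
            exact Real.add_one_le_exp _
      calc _ ≤ Real.log (|a q.1 + a q.2| * Real.exp (β / ε)) :=
            Real.log_le_log (abs_pos.2 (hc0 q)) h4
        _ = _ := by rw [Real.log_mul hpos.ne' (Real.exp_pos _).ne', Real.log_exp]
    rw [Finset.sum_add_distrib, Finset.sum_const, nsmul_eq_mul] at h3
    have h5 : ((Zᶜ).card : ℝ) * (β / ε) ≤ 1 := by
      refine le_trans ?_ hM
      have : (Zᶜ).card ≤ Fintype.card ι ^ 2 := by
        refine (Finset.card_le_univ _).trans_eq ?_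
        simp [sq]
      have h6 : ((Zᶜ).card : ℝ) ≤ (Fintype.card ι : ℝ) ^ 2 := by exact_mod_cast this
      gcongr
    linarith

/-- One step of the multiscale analysis: averaged over the coupling, the logarithmic weight of the
anti-resonant pairs hardly increases when the perturbation is added. -/
theorem lintegral_potential_add_smul_le (hε : 0 < ε) {R R' : ℝ} (hR : (Fintype.card ι : ℝ) ^ 2 ≤ R)
    (hRR : R < R') (hL : 3 ≤ Real.log (R' / R)) (hb1 : ε + 2 * (Fintype.card ι) ^ 2 * (R' * β) ≤ 1)
    (hb : (Fintype.card ι : ℝ) ^ 2 * (2 * (Fintype.card ι) ^ 2 * (R' * β) / ε) ≤ 1) :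
    ∫⁻ g in Set.Icc (-1 / 2 : ℝ) (1 / 2), potential ε' (hc g).eigenvalues₀
      ≤ ENNReal.ofReal (1 + 3 / Real.log (R' / R)) * potential ε hA.eigenvalues₀ + 3 := by
  set L := Real.log (R' / R) with hLdef
  by_cases htop : potential ε hA.eigenvalues₀ = ⊤
  · rw [htop, ENNReal.mul_top (by positivity)]
    simp
  set M : ℝ := (Fintype.card ι : ℝ) with hMdef
  have hM1 : 1 ≤ M := by
    rw [hMdef]
    exact_mod_cast (Fintype.card_pos : 0 < Fintype.card ι)
  have hM2 : 1 ≤ M ^ 2 := one_le_pow₀ hM1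
  have hR1 : 1 ≤ R := hM2.trans hR
  have hβR : β ≤ 2 * M ^ 2 * (R' * β) := by
    have : β ≤ R' * β := le_mul_of_one_le_left hβ (by linarith)
    nlinarith
  have h0 := add_ne_zero_of_potential_ne_top hε htop
  set a := hA.eigenvalues₀ with ha
  set Z := resonantPairs ε a with hZ
  set Ψ := ∑ q ∈ Z, -Real.log |a q.1 + a q.2| with hΨ
  have hmemZ {q : Fin (Fintype.card ι) × Fin (Fintype.card ι)} :
      q ∈ Z ↔ |a q.1 + a q.2| < ε := by simp [hZ, resonantPairs]
  have hβ' : M ^ 2 * (β / ε) ≤ 1 := by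
    refine le_trans ?_ hb
    gcongr
  have hΨ0 : 0 ≤ Ψ := Finset.sum_nonneg fun q hq => by
    have := hmemZ.1 hq
    linarith [Real.log_nonpos (abs_nonneg (a q.1 + a q.2)) (by linarith)]
  -- The coupling g becomes the complex variable of a polynomial of degree at most |ι|².
  set p := kronPoly A ((β : ℂ) • W) with hp
  have heval (z : ℂ) : p.eval z = (kronSum (A + (z * β) • W)).det := by
    rw [hp, eval_kronPoly, smul_smul]
  have heval' (g : ℝ) : p.eval (g : ℂ) = (kronSum (A + ((β * g : ℝ) : ℂ) • W)).det := by
    rw [heval]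
    push_cast
    rw [mul_comm]
  have hp0 : ‖p.eval 0‖ = ∏ q : _ × _, |a q.1 + a q.2| := by
    rw [heval, zero_mul, zero_smul, add_zero, norm_det_kronSum hA]
  have hp0' : p.eval 0 ≠ 0 := by
    rw [← norm_ne_zero_iff, hp0]
    exact Finset.prod_ne_zero_iff.2 fun q _ => abs_ne_zero.2 (h0 q)
  have hpA : ‖p.eval 0‖ = ‖(kronSum A).det‖ := by rw [hp0, norm_det_kronSum hA]
  have hpne : p ≠ 0 := by rintro h; simp [h] at hp0'
  -- A resonant factor stays at most ε + b ≤ 1, which costs a factor 1/|a_q|, in total e^Ψ. Each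
  -- other factor grows by at most e^(b/ε), in total at most e.
  have hcirc (z : ℂ) (hz : ‖z‖ = R') : ‖p.eval z‖ ≤ ‖p.eval 0‖ * Real.exp (Ψ + 1) := by
    set b := 2 * M ^ 2 * (R' * β) with hbdef
    have hb0 : 0 ≤ b := hβ.trans hβR
    rw [heval]
    refine (norm_det_kronSum_add_le' hA hW _).trans ?_
    rw [norm_mul, hz, Complex.norm_real, Real.norm_of_nonneg hβ, ← hbdef, hp0]
    calc ∏ q : _ × _, (|a q.1 + a q.2| + b)
        ≤ ∏ q : _ × _, |a q.1 + a q.2|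
            * Real.exp (if q ∈ Z then -Real.log |a q.1 + a q.2| else b / ε) := by
          refine Finset.prod_le_prod (fun q _ => by positivity) fun q _ => ?_
          have hpos := abs_pos.2 (h0 q)
          split_ifs with hq
          · rw [Real.exp_neg, Real.exp_log hpos, mul_inv_cancel₀ hpos.ne']
            have := hmemZ.1 hq
            linarith
          · rw [hmemZ, not_lt] at hq
            calc |a q.1 + a q.2| + b = |a q.1 + a q.2| + ε * (b / ε) := by field_simp
              _ ≤ |a q.1 + a q.2| + |a q.1 + a q.2| * (b / ε) := by gcongr
              _ = |a q.1 + a q.2| * (b / ε + 1) := by ring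
              _ ≤ _ := by
                gcongr
                exact Real.add_one_le_exp _
      _ ≤ _ := by
          rw [Finset.prod_mul_distrib, ← Real.exp_sum]
          gcongr
          rw [Finset.sum_ite, Finset.sum_const, nsmul_eq_mul]
          have h6 : (((Finset.univ.filter fun q => q ∉ Z).card : ℕ) : ℝ) ≤ M ^ 2 := by
            have : (Finset.univ.filter fun q => q ∉ Z).card ≤ Fintype.card ι ^ 2 := by
              refine (Finset.card_le_univ _).trans_eq ?_
              simp [sq]
            rw [hMdef]
            exact_mod_cast this
          have h7 : (((Finset.univ.filter fun q => q ∉ Z).card : ℕ) : ℝ) * (b / ε)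
              ≤ M ^ 2 * (b / ε) := by gcongr
          rw [Finset.filter_mem_eq_inter, Finset.univ_inter]
          linarith
  have hmain := log_norm_eval_zero_sub_integral_le (natDegree_kronPoly_le A ((β : ℂ) • W)) hp0'
    hR1 hRR hcirc
  have hint := intervalIntegrable_log_norm_eval p (-1 / 2) (1 / 2)
  set G : ℝ → ℝ := fun g => Real.log ‖p.eval 0‖ - Real.log ‖p.eval (g : ℂ)‖ + Ψ + 1 with hG
  have hptw : ∀ᵐ g ∂(volume.restrict (Set.Icc (-1 / 2 : ℝ) (1 / 2))),
      0 ≤ G g ∧ potential ε' (hc g).eigenvalues₀ ≤ ENNReal.ofReal (G g) := by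
    filter_upwards [ae_restrict_of_ae (ae_eval_ofReal_ne_zero hpne),
      ae_restrict_mem measurableSet_Icc] with g hg0 hg
    have hg' : |g| ≤ 1 / 2 := abs_le.2 ⟨by linarith [hg.1], hg.2⟩
    rw [heval'] at hg0
    obtain ⟨F, hF0, hF1, hF2⟩ := potential_add_smul_le hA hW hβ hεε hc hg' hε
      (by linarith) hβ' h0 hg0
    have hFG : F ≤ G g := by
      rw [hG]
      simp only
      rw [hpA, heval']
      exact hF2
    exact ⟨hF0.trans hFG, hF1.trans (ENNReal.ofReal_le_ofReal hFG)⟩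
  have hGint : IntervalIntegrable G volume (-1 / 2) (1 / 2) :=
    ((intervalIntegrable_const.sub hint).add intervalIntegrable_const).add intervalIntegrable_const
  have hGint' : Integrable G (volume.restrict (Set.Icc (-1 / 2 : ℝ) (1 / 2))) := by
    have := (intervalIntegrable_iff_integrableOn_Icc_of_le (by norm_num)).1 hGint
    exact this
  calc _ ≤ ∫⁻ g in Set.Icc (-1 / 2 : ℝ) (1 / 2), ENNReal.ofReal (G g) :=
        lintegral_mono_ae (hptw.mono fun g hg => hg.2)
    _ = ENNReal.ofReal (∫ g in Set.Icc (-1 / 2 : ℝ) (1 / 2), G g) :=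
        (ofReal_integral_eq_lintegral_ofReal hGint' (hptw.mono fun g hg => hg.1)).symm
    _ ≤ ENNReal.ofReal ((1 + 3 / L) * Ψ + 3) := by
        -- The additive 3 collects the 1 already in G, the term |ι|²/R ≤ 1 of the far roots, and 3/L
        -- ≤ 1 from the 1 in T = Ψ + 1.
        refine ENNReal.ofReal_le_ofReal ?_
        rw [integral_Icc_eq_integral_Ioc, ← intervalIntegral.integral_of_le (by norm_num), hG,
          intervalIntegral.integral_add ((intervalIntegrable_const.sub hint).add
            intervalIntegrable_const) intervalIntegrable_const,
          intervalIntegral.integral_add (intervalIntegrable_const.sub hint)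
            intervalIntegrable_const,
          intervalIntegral.integral_sub intervalIntegrable_const hint,
          intervalIntegral.integral_const, intervalIntegral.integral_const,
          intervalIntegral.integral_const]
        have h8 : ((Fintype.card ι ^ 2 : ℕ) : ℝ) / R ≤ 1 := by
          rw [div_le_one (by linarith), Nat.cast_pow]
          exact hR
        have h9 : 3 / L ≤ 1 := by
          rw [div_le_one (by linarith)]
          exact hL
        have h10 : 3 * ((Ψ + 1) / L) = 3 / L * Ψ + 3 / L := by ring
        rw [← hp, ← hLdef, h10] at hmain
        have h11 : (1 / 2 : ℝ) - -1 / 2 = 1 := by norm_num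
        rw [h11]
        simp only [one_smul]
        linarith
    _ = _ := by
        rw [ENNReal.ofReal_add (by positivity) (by norm_num), ENNReal.ofReal_mul (by positivity),
          potential_eq_ofReal (by linarith) h0, ENNReal.ofReal_ofNat]

end Step

end QuantumSun

end

/-! ### Adding one spin: tensor structure and the spectrum before coupling. -/

noncomputable section

namespace QuantumSun

open scoped Matrix.Norms.L2Operator Kronecker ENNReal

/-- Splitting off the spin at the last site. -/
def lastEquiv (n : ℕ) : Config (n + 1) ≃ ℤˣ × Config n := (Fin.snocEquiv fun _ => ℤˣ).symm

theorem lastEquiv_apply {n : ℕ} (σ : Config (n + 1)) :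
    lastEquiv n σ = (σ (Fin.last n), Fin.init σ) := rfl

/-- The operator `M ⊗ 1` on `n + 1` spins. -/
def embed {n : ℕ} (M : Matrix (Config n) (Config n) ℂ) :
    Matrix (Config (n + 1)) (Config (n + 1)) ℂ :=
  ((1 : Matrix ℤˣ ℤˣ ℂ) ⊗ₖ M).submatrix (lastEquiv n) (lastEquiv n)

theorem embed_apply {n : ℕ} (M : Matrix (Config n) (Config n) ℂ) (σ τ : Config (n + 1)) :
    embed M σ τ = if σ (Fin.last n) = τ (Fin.last n) then M (Fin.init σ) (Fin.init τ) else 0 := by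
  rw [embed, Matrix.submatrix_apply, Matrix.kronecker_apply, lastEquiv_apply, lastEquiv_apply,
    Matrix.one_apply, ite_mul, one_mul, zero_mul]

theorem embed_mul {n : ℕ} (M N : Matrix (Config n) (Config n) ℂ) :
    embed (M * N) = embed M * embed N := by
  rw [embed, embed, embed, Matrix.submatrix_mul_equiv, ← Matrix.mul_kronecker_mul, one_mul]

theorem embed_one {n : ℕ} : embed (1 : Matrix (Config n) (Config n) ℂ) = 1 := by
  rw [embed, Matrix.one_kronecker_one, Matrix.submatrix_one_equiv]

theorem embed_star {n : ℕ} (M : Matrix (Config n) (Config n) ℂ) :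
    embed (star M) = star (embed M) := by
  ext σ τ
  rw [Matrix.star_apply, embed_apply, embed_apply, Matrix.star_apply]
  simp only [eq_comm (a := τ (Fin.last n))]
  split_ifs <;> simp

theorem embed_add {n : ℕ} (M N : Matrix (Config n) (Config n) ℂ) :
    embed (M + N) = embed M + embed N := by
  rw [embed, Matrix.kronecker_add]; rfl

theorem embed_smul {n : ℕ} (c : ℂ) (M : Matrix (Config n) (Config n) ℂ) :
    embed (c • M) = c • embed M := by
  rw [embed, Matrix.kronecker_smul]; rfl

theorem embed_zero {n : ℕ} : embed (0 : Matrix (Config n) (Config n) ℂ) = 0 := by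
  rw [embed, Matrix.kronecker_zero]; rfl

theorem embed_sum {n : ℕ} {κ : Type*} (s : Finset κ) (M : κ → Matrix (Config n) (Config n) ℂ) :
    embed (∑ i ∈ s, M i) = ∑ i ∈ s, embed (M i) := by
  classical
  induction s using Finset.induction_on with
  | empty => simp [embed_zero]
  | insert a s ha ih => rw [Finset.sum_insert ha, Finset.sum_insert ha, embed_add, ih]

theorem embed_diagonal {n : ℕ} (d : Config n → ℂ) :
    embed (Matrix.diagonal d) = Matrix.diagonal fun σ => d (Fin.init σ) := by
  rw [embed, ← Matrix.diagonal_one, Matrix.diagonal_kronecker_diagonal,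
    Matrix.submatrix_diagonal_equiv]
  simp [Function.comp_def, lastEquiv_apply]

theorem init_eq_and_last_eq_iff {n : ℕ} (σ τ : Config (n + 1)) :
    σ = τ ↔ Fin.init σ = Fin.init τ ∧ σ (Fin.last n) = τ (Fin.last n) := by
  rw [← (lastEquiv n).apply_eq_iff_eq, lastEquiv_apply, lastEquiv_apply, Prod.mk.injEq, and_comm]

theorem embed_pauliZ {n : ℕ} (j : Fin n) : embed (pauliZ j) = pauliZ j.castSucc := by
  rw [pauliZ, embed_diagonal]; rfl

theorem embed_pauliX {n : ℕ} (j : Fin n) : embed (pauliX j) = pauliX j.castSucc := by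
  ext σ τ
  rw [embed_apply]
  simp only [pauliX, Matrix.of_apply, init_eq_and_last_eq_iff σ]
  have h1 : Fin.init (Function.update τ j.castSucc (-τ j.castSucc))
      = Function.update (Fin.init τ) j (-(Fin.init τ : Config n) j) :=
    Fin.init_update_castSucc (α := fun _ => ℤˣ) τ j _
  have h2 : Function.update τ j.castSucc (-τ j.castSucc) (Fin.last n) = τ (Fin.last n) :=
    Function.update_of_ne (Fin.castSucc_lt_last j).ne' _ _
  rw [h1, h2]
  split_ifs <;> simp_all

theorem embed_bathOp {nB : ℕ} (HB : Matrix (Config nB) (Config nB) ℂ) {n : ℕ} (hn : nB ≤ n) :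
    bathOp HB (n + 1) = embed (bathOp HB n) := by
  ext σ τ
  rw [embed_apply]
  have hb (σ : Config (n + 1)) : σ.bath nB = Config.bath nB (Fin.init σ : Config n) := by
    ext i
    have h1 : (i : ℕ) < n := i.2.trans_le hn
    simp only [Config.bath, dif_pos h1, dif_pos (h1.trans (Nat.lt_succ_self n))]
    rfl
  simp only [bathOp, Matrix.of_apply, hb, Fin.forall_fin_succ', Fin.val_last, hn, forall_const,
    Fin.val_castSucc]
  by_cases h1 : σ (Fin.last n) = τ (Fin.last n)
  · simp only [h1, and_true, if_true]
    rfl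
  · simp only [h1, and_false, if_false]

/-- This is the form A + βgW of the one-step estimate, with β = α^(n+1) and W = X_1 X_{n+1} unitary.
-/
theorem hamiltonian_succ {nB : ℕ} (HB : Matrix (Config nB) (Config nB) ℂ) (α : ℝ) (h g : ℕ → ℝ)
    {n : ℕ} (hn : nB ≤ n) :
    hamiltonian HB α h g (n + 1) =
      (embed (hamiltonian HB α h g n) + ((h (n + 1) : ℝ) : ℂ) • pauliZ (Fin.last n))
        + ((α ^ (n + 1) * g (n + 1) : ℝ) : ℂ) • (pauliX 0 * pauliX (Fin.last n)) := by
  rw [hamiltonian, hamiltonian, Finset.sum_filter, Finset.sum_filter, Fin.sum_univ_castSucc,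
    embed_add, embed_sum, embed_bathOp HB hn, if_pos (by simpa using hn)]
  have h1 : ∀ j : Fin n, (if nB ≤ ((j.castSucc : Fin (n + 1)) : ℕ) then
      (((h ((j.castSucc : Fin (n + 1)) + 1) : ℝ) : ℂ) • pauliZ j.castSucc
        + ((α ^ (((j.castSucc : Fin (n + 1)) : ℕ) + 1) * g ((j.castSucc : Fin (n + 1)) + 1) : ℝ) : ℂ)
          • (pauliX ⟨0, j.castSucc.pos⟩ * pauliX j.castSucc)) else 0)
      = embed (if nB ≤ (j : ℕ) then (((h (j + 1) : ℝ) : ℂ) • pauliZ j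
        + ((α ^ ((j : ℕ) + 1) * g (j + 1) : ℝ) : ℂ) • (pauliX ⟨0, j.pos⟩ * pauliX j)) else 0) := by
    intro j
    simp only [Fin.val_castSucc]
    split_ifs
    · rw [embed_add, embed_smul, embed_smul, embed_mul, embed_pauliZ, embed_pauliX, embed_pauliX]
      rfl
    · rw [embed_zero]
  rw [Finset.sum_congr rfl fun j _ => h1 j]
  simp only [Fin.val_last]
  simp only [add_assoc]
  rfl

theorem pauliX_mul_self {n : ℕ} (j : Fin n) : pauliX j * pauliX j = 1 := by
  ext σ τ
  simp only [pauliX, Matrix.mul_apply, Matrix.of_apply, mul_ite, mul_one, mul_zero,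
    Finset.sum_ite_eq', Finset.mem_univ, if_true, Matrix.one_apply]
  simp

theorem pauliX_mul_pauliX_mem_unitaryGroup {n : ℕ} (j k : Fin n) :
    pauliX j * pauliX k ∈ Matrix.unitaryGroup (Config n) ℂ := by
  have h (j : Fin n) : pauliX j ∈ Matrix.unitaryGroup (Config n) ℂ := by
    rw [Matrix.mem_unitaryGroup_iff, Matrix.star_eq_conjTranspose, (pauliX_isHermitian j).eq,
      pauliX_mul_self]
  exact mul_mem (h j) (h k)

/-- The ordered enumeration does not respect the product structure of the spectrum, so spectra are
compared as multisets, through symmetric sums. -/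
theorem sum_comp_eq_of_map_eq {κ κ' M : Type*} [Fintype κ] [Fintype κ'] [AddCommMonoid M]
    {a : κ → ℝ} {d : κ' → ℝ} (h : Finset.univ.val.map a = Finset.univ.val.map d) (F : ℝ → M) :
    ∑ i, F (a i) = ∑ j, F (d j) := by
  have := congrArg (fun s => (s.map F).sum) h
  rw [Multiset.map_map, Multiset.map_map] at this
  exact this

theorem sum_pair_eq_of_map_eq {κ κ' M : Type*} [Fintype κ] [Fintype κ'] [AddCommMonoid M]
    {a : κ → ℝ} {d : κ' → ℝ} (h : Finset.univ.val.map a = Finset.univ.val.map d) (F : ℝ → M) :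
    ∑ q : κ × κ, F (a q.1 + a q.2) = ∑ q : κ' × κ', F (d q.1 + d q.2) := by
  rw [Fintype.sum_prod_type, Fintype.sum_prod_type]
  simp only
  rw [← sum_comp_eq_of_map_eq h fun x => ∑ j, F (x + d j)]
  exact Finset.sum_congr rfl fun i _ => sum_comp_eq_of_map_eq h fun x => F (a i + x)

theorem map_eigenvalues_eq {ι : Type*} [Fintype ι] [DecidableEq ι] {A : Matrix ι ι ℂ}
    (hA : A.IsHermitian) :
    Finset.univ.val.map hA.eigenvalues = Finset.univ.val.map hA.eigenvalues₀ :=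
  (map_eigenvalues₀_eq hA (Unitary.coe_mul_star_self hA.eigenvectorUnitary) _
    (eq_eigenvectorUnitary_conj hA)).symm

/-- The sums of two levels of `H ⊗ 1 + t Z`, where `Z` acts on the last spin. -/
theorem sum_pair_embed {n : ℕ} {H : Matrix (Config n) (Config n) ℂ} (hH : H.IsHermitian) (t : ℝ)
    (hA : (embed H + (t : ℂ) • pauliZ (Fin.last n)).IsHermitian) {M : Type*} [AddCommMonoid M]
    (F : ℝ → M) :
    ∑ q : Fin (Fintype.card (Config (n + 1))) × Fin (Fintype.card (Config (n + 1))),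
        F (hA.eigenvalues₀ q.1 + hA.eigenvalues₀ q.2)
      = ∑ q : Fin (Fintype.card (Config n)) × Fin (Fintype.card (Config n)),
        (2 • F (hH.eigenvalues₀ q.1 + hH.eigenvalues₀ q.2)
          + F (hH.eigenvalues₀ q.1 + hH.eigenvalues₀ q.2 + 2 * t)
          + F (hH.eigenvalues₀ q.1 + hH.eigenvalues₀ q.2 - 2 * t)) := by
  set U : Matrix (Config n) (Config n) ℂ := 
    (hH.eigenvectorUnitary : Matrix (Config n) (Config n) ℂ) with hU
  have hUU : U * star U = 1 := Unitary.coe_mul_star_self _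
  let d : Config (n + 1) → ℝ := fun σ =>
    hH.eigenvalues (Fin.init σ) + t * ((σ (Fin.last n) : ℤˣ) : ℤ)
  have hZ : pauliZ (Fin.last n)
      = ((Matrix.diagonal fun μ : ℤˣ => (((μ : ℤˣ) : ℤ) : ℂ)) ⊗ₖ
        (1 : Matrix (Config n) (Config n) ℂ)).submatrix (lastEquiv n) (lastEquiv n) := by
    rw [← Matrix.diagonal_one, Matrix.diagonal_kronecker_diagonal,
      Matrix.submatrix_diagonal_equiv]
    simp [Function.comp_def, lastEquiv_apply, pauliZ]
  have hZU : embed U * pauliZ (Fin.last n) * star (embed U) = pauliZ (Fin.last n) := by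
    rw [← embed_star, hZ, embed, embed, Matrix.submatrix_mul_equiv, Matrix.submatrix_mul_equiv,
      ← Matrix.mul_kronecker_mul, ← Matrix.mul_kronecker_mul, mul_one, mul_one, hUU, one_mul]
  have hV : embed U * star (embed U) = 1 := by rw [← embed_star, ← embed_mul, hUU, embed_one]
  have hdiag : embed H + (t : ℂ) • pauliZ (Fin.last n)
      = embed U * Matrix.diagonal (fun σ => (d σ : ℂ)) * star (embed U) := by
    have h1 : Matrix.diagonal (fun σ => (d σ : ℂ))
        = embed (Matrix.diagonal fun σ => (hH.eigenvalues σ : ℂ))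
          + (t : ℂ) • pauliZ (Fin.last n) := by
      rw [embed_diagonal, pauliZ, ← Matrix.diagonal_smul, Matrix.diagonal_add]
      congr 1
      ext σ
      simp [d]
    rw [h1, mul_add, add_mul, mul_smul_comm, smul_mul_assoc, hZU, ← embed_star, ← embed_mul,
      ← embed_mul, ← eq_eigenvectorUnitary_conj hH]
  rw [sum_pair_eq_of_map_eq (map_eigenvalues₀_eq hA hV d hdiag) F]
  have key := sum_pair_eq_of_map_eq (map_eigenvalues_eq hH)
    fun s => 2 • F s + F (s + 2 * t) + F (s - 2 * t)
  rw [← key, Fintype.sum_prod_type, Fintype.sum_prod_type]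
  have hsum {N : Type _} [AddCommMonoid N] (G : Config (n + 1) → N) :
      ∑ σ, G σ = ∑ τ, (G ((lastEquiv n).symm (1, τ)) + G ((lastEquiv n).symm (-1, τ))) := by
    rw [← (lastEquiv n).symm.sum_comp, Fintype.sum_prod_type_right]
    refine Finset.sum_congr rfl fun τ _ => ?_
    rw [UnitsInt.univ]
    simp
  have hd (μ : ℤˣ) (τ : Config n) :
      d ((lastEquiv n).symm (μ, τ)) = hH.eigenvalues τ + t * ((μ : ℤˣ) : ℤ) := by
    have h1 := (lastEquiv n).apply_symm_apply (μ, τ)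
    rw [lastEquiv_apply, Prod.mk.injEq] at h1
    simp only [d, h1]
  simp only
  rw [hsum]
  refine Finset.sum_congr rfl fun τ _ => ?_
  rw [hsum, hsum, ← Finset.sum_add_distrib]
  refine Finset.sum_congr rfl fun τ' _ => ?_
  simp only [hd]
  -- Equal last spins shift the pair sum by ±2t. Opposite spins cancel the field, which gives two
  -- copies of the old sum.
  have e1 : hH.eigenvalues τ + t * ((1 : ℤˣ) : ℤ) + (hH.eigenvalues τ' + t * ((1 : ℤˣ) : ℤ))
      = hH.eigenvalues τ + hH.eigenvalues τ' + 2 * t := by push_cast; ring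
  have e2 : hH.eigenvalues τ + t * ((1 : ℤˣ) : ℤ) + (hH.eigenvalues τ' + t * ((-1 : ℤˣ) : ℤ))
      = hH.eigenvalues τ + hH.eigenvalues τ' := by push_cast; ring
  have e3 : hH.eigenvalues τ + t * ((-1 : ℤˣ) : ℤ) + (hH.eigenvalues τ' + t * ((1 : ℤˣ) : ℤ))
      = hH.eigenvalues τ + hH.eigenvalues τ' := by push_cast; ring
  have e4 : hH.eigenvalues τ + t * ((-1 : ℤˣ) : ℤ) + (hH.eigenvalues τ' + t * ((-1 : ℤˣ) : ℤ))
      = hH.eigenvalues τ + hH.eigenvalues τ' - 2 * t := by push_cast; ring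
  rw [e1, e2, e3, e4, two_nsmul]
  abel

theorem embed_add_smul_isHermitian {n : ℕ} {H : Matrix (Config n) (Config n) ℂ}
    (hH : H.IsHermitian) (t : ℝ) : (embed H + (t : ℂ) • pauliZ (Fin.last n)).IsHermitian := by
  refine Matrix.IsHermitian.add ?_ ?_
  · have := embed_star H
    rw [Matrix.star_eq_conjTranspose, hH.eq] at this
    exact this.symm
  · have hr : IsSelfAdjoint (t : ℂ) := Complex.conj_ofReal t
    rw [Matrix.IsHermitian, Matrix.conjTranspose_smul, (pauliZ_isHermitian _).eq, hr.star_eq]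

section Levels

variable {nB : ℕ} {HB : Matrix (Config nB) (Config nB) ℂ} (hHB : HB.IsHermitian)

/-- The eigenvalues of `H_n` in decreasing order, as a function of the disorder. -/
def energy (α : ℝ) (n : ℕ) (x : (ℕ → ℝ) × (ℕ → ℝ)) : Fin (Fintype.card (Config n)) → ℝ :=
  (hamiltonian_isHermitian hHB α x.1 x.2 n).eigenvalues₀

theorem continuous_energy (α : ℝ) (n : ℕ) (i : Fin (Fintype.card (Config n))) :
    Continuous fun x => energy hHB α n x i := by
  refine continuous_eigenvalues₀ (F := fun x : (ℕ → ℝ) × (ℕ → ℝ) => hamiltonian HB α x.1 x.2 n)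
    (fun x => hamiltonian_isHermitian hHB α x.1 x.2 n) ?_ i
  unfold hamiltonian
  refine continuous_const.add (continuous_finsetSum _ fun j _ => ?_)
  have h1 : Continuous fun x : (ℕ → ℝ) × (ℕ → ℝ) => ((x.1 (j + 1) : ℝ) : ℂ) := by fun_prop
  have h2 : Continuous fun x : (ℕ → ℝ) × (ℕ → ℝ) =>
      ((α ^ ((j : ℕ) + 1) * x.2 (j + 1) : ℝ) : ℂ) := by fun_prop
  exact (h1.smul continuous_const).add (h2.smul continuous_const)

/-- No sum of two levels is close to `± 2 t`. -/
def Separated (ε : ℝ) {κ : Type*} (a : κ → ℝ) (t : ℝ) : Prop :=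
  ∀ q : κ × κ, ε ≤ |a q.1 + a q.2 + 2 * t| ∧ ε ≤ |a q.1 + a q.2 - 2 * t|

theorem hamiltonian_congr {α : ℝ} {h g h' g' : ℕ → ℝ} {n : ℕ}
    (hh : ∀ i, nB < i → i ≤ n → h i = h' i) (hg : ∀ i, nB < i → i ≤ n → g i = g' i) :
    hamiltonian HB α h g n = hamiltonian HB α h' g' n := by
  unfold hamiltonian
  congr 1
  refine Finset.sum_congr rfl fun j hj => ?_
  have h1 : nB ≤ (j : ℕ) := (Finset.mem_filter.1 hj).2
  rw [hh _ (by omega) (by omega), hg _ (by omega) (by omega)]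

end Levels

end QuantumSun

end

/-! ### Numerical inequalities for the thresholds. -/

noncomputable section

namespace QuantumSun

open scoped ENNReal

/-- The anti-resonance threshold at `n` spins. -/
def threshold (α θ : ℝ) (n : ℕ) : ℝ := α ^ (θ * n) / 4

section Numerics

variable {α θ : ℝ} (hθ : 2 / 3 < θ) (hθ' : θ < 1) (hα : 0 < α)
  (hα' : α ≤ Real.exp (-(20 / (1 - θ))))

include hα in
theorem threshold_eq (n : ℕ) : threshold α θ n = Real.exp (Real.log α * (θ * n)) / 4 := by
  rw [threshold, Real.rpow_def_of_pos hα]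

include hα in
theorem threshold_pos (n : ℕ) : 0 < threshold α θ n := by
  rw [threshold_eq hα]; positivity

include hθ hθ' hα hα'

theorem log_le_and : Real.log α ≤ -60 ∧ Real.log α * (1 - θ) ≤ -20 := by
  have h1 : Real.log α ≤ -(20 / (1 - θ)) := by
    have := Real.log_le_log hα hα'
    rwa [Real.log_exp] at this
  have h2 : 0 < 1 - θ := by linarith
  constructor
  · have : 60 ≤ 20 / (1 - θ) := by rw [le_div_iff₀ h2]; linarith
    linarith
  · calc Real.log α * (1 - θ) ≤ -(20 / (1 - θ)) * (1 - θ) := by gcongr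
      _ = -20 := by field_simp

theorem log_mul_theta_le : Real.log α * θ ≤ -40 := by
  have := (log_le_and hθ hθ' hα hα').1
  nlinarith

theorem threshold_le (n : ℕ) : threshold α θ n ≤ Real.exp (-40 * n) / 4 := by
  rw [threshold_eq hα, ← mul_assoc]
  refine div_le_div_of_nonneg_right (Real.exp_le_exp.2 ?_) (by norm_num)
  exact mul_le_mul_of_nonneg_right (log_mul_theta_le hθ hθ' hα hα') (Nat.cast_nonneg n)

theorem threshold_le_quarter (n : ℕ) : threshold α θ n ≤ 1 / 4 := by
  refine (threshold_le hθ hθ' hα hα' n).trans ?_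
  have : Real.exp (-40 * n) ≤ 1 := Real.exp_le_one_iff.2 (by
    have : (0 : ℝ) ≤ n := Nat.cast_nonneg n
    linarith)
  linarith

theorem le_neg_log_threshold (n : ℕ) : (n : ℝ) ≤ -Real.log (threshold α θ n) := by
  have h1 := Real.log_le_log (threshold_pos (θ := θ) hα n)
    ((threshold_le hθ hθ' hα hα' n).trans (div_le_self (Real.exp_pos _).le (by norm_num)))
  rw [Real.log_exp] at h1
  have : (0 : ℝ) ≤ n := Nat.cast_nonneg n
  linarith

/-- The smallness condition of the one-step estimate with |ι|² = 4^(n+1), R' = 16^n e^(12n) and β =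
α^(n+1). Four times the left side is at most exp(7 + 20n + (n+1) log α). Here (1 - θ) log α ≤ -20
absorbs 20n, and log α ≤ -60 absorbs 7. -/
theorem perturbation_le_threshold (n : ℕ) :
    (4 : ℝ) ^ (n + 1) * (2 * 4 ^ (n + 1) * (16 ^ n * Real.exp (12 * n) * α ^ (n + 1)))
      ≤ threshold α θ n := by
  obtain ⟨h1, h2⟩ := log_le_and hθ hθ' hα hα'
  have e1 : (2 : ℝ) ≤ Real.exp 1 := by
    have := Real.add_one_le_exp 1; linarith
  have e4 : (4 : ℝ) ≤ Real.exp 2 := by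
    have : Real.exp 2 = Real.exp 1 * Real.exp 1 := by rw [← Real.exp_add]; norm_num
    nlinarith
  have e16 : (16 : ℝ) ≤ Real.exp 4 := by
    have : Real.exp 4 = Real.exp 2 * Real.exp 2 := by rw [← Real.exp_add]; norm_num
    nlinarith
  have hαn : α ^ (n + 1) = Real.exp (Real.log α * ((n : ℝ) + 1)) := by
    rw [← Real.rpow_natCast, Real.rpow_def_of_pos hα]
    push_cast
    rfl
  rw [threshold_eq hα, le_div_iff₀ (by norm_num), hαn]
  calc _ ≤ Real.exp 2 ^ (n + 1) * (Real.exp 1 * Real.exp 2 ^ (n + 1)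
        * (Real.exp 4 ^ n * Real.exp (12 * n) * Real.exp (Real.log α * ((n : ℝ) + 1))))
        * Real.exp 2 := by gcongr
    _ = Real.exp (7 + 20 * n + Real.log α * ((n : ℝ) + 1)) := by
      simp only [← Real.exp_nat_mul, ← Real.exp_add]
      congr 1
      push_cast
      ring
    _ ≤ _ := by
      gcongr
      have : (0 : ℝ) ≤ n := Nat.cast_nonneg n
      nlinarith

theorem pow_le_threshold (n : ℕ) : 32 * α ^ (n + 1) ≤ threshold α θ n := by
  refine le_trans ?_ (perturbation_le_threshold hθ hθ' hα hα' n)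
  have h4 : (4 : ℝ) ≤ 4 ^ (n + 1) := by
    rw [pow_succ]; linarith [one_le_pow₀ (by norm_num : (1 : ℝ) ≤ 4) (n := n)]
  have h16 : (1 : ℝ) ≤ 16 ^ n := one_le_pow₀ (by norm_num)
  have he : 1 ≤ Real.exp (12 * n) := Real.one_le_exp (by positivity)
  calc 32 * α ^ (n + 1) = 4 * (2 * 4 * (1 * 1 * α ^ (n + 1))) := by ring
    _ ≤ _ := by gcongr

/-- The threshold at least halves at each step, since α^θ ≤ 1/2, and α^(n+1) is at most 1/32 of it.
This lets the coupling be absorbed in the change of threshold. -/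
theorem threshold_succ_add_le (n : ℕ) :
    threshold α θ (n + 1) + α ^ (n + 1) ≤ threshold α θ n := by
  have h1 := pow_le_threshold hθ hθ' hα hα' n
  have h2 : threshold α θ (n + 1) ≤ threshold α θ n / 2 := by
    have : Real.exp (Real.log α * (θ * ((n + 1 : ℕ) : ℝ)))
        = Real.exp (Real.log α * (θ * n)) * Real.exp (Real.log α * θ) := by
      rw [← Real.exp_add]; congr 1; push_cast; ring
    rw [threshold_eq hα, threshold_eq hα, this]
    have h3 : Real.exp (Real.log α * θ) ≤ 1 / 2 := by
      have h40 := log_mul_theta_le hθ hθ' hα hα'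
      calc Real.exp (Real.log α * θ) ≤ Real.exp (-1) := by gcongr; linarith
        _ ≤ 1 / 2 := by
          rw [Real.exp_neg, one_div]
          have := Real.add_one_le_exp 1
          gcongr
          linarith
    have := Real.exp_pos (Real.log α * (θ * n))
    nlinarith
  have := pow_pos hα (n + 1)
  linarith

end Numerics

theorem eigenvalues₀_congr {ι : Type*} [Fintype ι] [DecidableEq ι] {A B : Matrix ι ι ℂ}
    (hA : A.IsHermitian) (hB : B.IsHermitian) (h : A = B) : hA.eigenvalues₀ = hB.eigenvalues₀ := by
  subst h; rfl

theorem card_config (n : ℕ) : Fintype.card (Config n) = 2 ^ n := by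
  simp [Config]

/-! ### The one-step estimates for the Hamiltonians H_n. -/

section Model

variable {nB : ℕ} {HB : Matrix (Config nB) (Config nB) ℂ} (hHB : HB.IsHermitian)

theorem energy_congr {α : ℝ} {n : ℕ} {x y : (ℕ → ℝ) × (ℕ → ℝ)}
    (hh : ∀ i, nB < i → i ≤ n → x.1 i = y.1 i) (hg : ∀ i, nB < i → i ≤ n → x.2 i = y.2 i) :
    energy hHB α n x = energy hHB α n y :=
  eigenvalues₀_congr _ _ (hamiltonian_congr hh hg)

theorem hamiltonian_succ_update {α : ℝ} {n : ℕ} (hn : nB ≤ n) (x : (ℕ → ℝ) × (ℕ → ℝ)) (v : ℝ) :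
    hamiltonian HB α x.1 (Function.update x.2 (n + 1) v) (n + 1)
      = (embed (hamiltonian HB α x.1 x.2 n) + ((x.1 (n + 1) : ℝ) : ℂ) • pauliZ (Fin.last n))
        + ((α ^ (n + 1) * v : ℝ) : ℂ) • (pauliX 0 * pauliX (Fin.last n)) := by
  rw [hamiltonian_succ HB α _ _ hn, Function.update_self,
    hamiltonian_congr (n := n) (fun _ _ _ => rfl)
      fun i _ hi => Function.update_of_ne (by omega : i ≠ n + 1) v x.2]

include hHB in
/-- `H_n + h_{n+1} Z_{n+1}` is Hermitian. -/
theorem unperturbed_isHermitian (α : ℝ) (n : ℕ) (x : (ℕ → ℝ) × (ℕ → ℝ)) :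
    (embed (hamiltonian HB α x.1 x.2 n)
      + ((x.1 (n + 1) : ℝ) : ℂ) • pauliZ (Fin.last n)).IsHermitian :=
  embed_add_smul_isHermitian (hamiltonian_isHermitian hHB α x.1 x.2 n) _

include hHB in
theorem perturbed_isHermitian (α : ℝ) {n : ℕ} (hn : nB ≤ n) (x : (ℕ → ℝ) × (ℕ → ℝ)) (v : ℝ) :
    (embed (hamiltonian HB α x.1 x.2 n) + ((x.1 (n + 1) : ℝ) : ℂ) • pauliZ (Fin.last n)
      + ((α ^ (n + 1) * v : ℝ) : ℂ) • (pauliX 0 * pauliX (Fin.last n))).IsHermitian := by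
  rw [← hamiltonian_succ_update hn]
  exact hamiltonian_isHermitian hHB _ _ _ _

theorem energy_succ_update {α : ℝ} {n : ℕ} (hn : nB ≤ n) (x : (ℕ → ℝ) × (ℕ → ℝ)) (v : ℝ) :
    energy hHB α (n + 1) (x.1, Function.update x.2 (n + 1) v)
      = (perturbed_isHermitian hHB α hn x v).eigenvalues₀ :=
  eigenvalues₀_congr _ _ (hamiltonian_succ_update hn x v)

/-- Separation removes the sums shifted by ±2h_{n+1}; the two copies with opposite spins remain. The
weight doubles just as the number of levels does, so the field does not raise the weight per level.
-/
theorem potential_unperturbed {α ε : ℝ} {n : ℕ} {x : (ℕ → ℝ) × (ℕ → ℝ)}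
    (hs : Separated ε (energy hHB α n x) (x.1 (n + 1))) :
    potential ε (unperturbed_isHermitian hHB α n x).eigenvalues₀
      = 2 * potential ε (energy hHB α n x) := by
  rw [potential, sum_pair_embed (hamiltonian_isHermitian hHB α x.1 x.2 n), potential,
    Finset.mul_sum]
  refine Finset.sum_congr rfl fun q _ => ?_
  have h1 : logWeight ε (energy hHB α n x q.1 + energy hHB α n x q.2 + 2 * x.1 (n + 1)) = 0 := by
    rw [logWeight, if_neg (not_lt.2 (hs q).1)]
  have h2 : logWeight ε (energy hHB α n x q.1 + energy hHB α n x q.2 - 2 * x.1 (n + 1)) = 0 := by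
    rw [logWeight, if_neg (not_lt.2 (hs q).2)]
  unfold energy at h1 h2 ⊢
  rw [h1, h2, add_zero, add_zero, two_nsmul, two_mul]

theorem card_resonantPairs_unperturbed {α ε : ℝ} {n : ℕ} {x : (ℕ → ℝ) × (ℕ → ℝ)}
    (hs : Separated ε (energy hHB α n x) (x.1 (n + 1))) :
    (resonantPairs ε (unperturbed_isHermitian hHB α n x).eigenvalues₀).card
      = 2 * (resonantPairs ε (energy hHB α n x)).card := by
  have hF := sum_pair_embed (hamiltonian_isHermitian hHB α x.1 x.2 n) (x.1 (n + 1))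
    (unperturbed_isHermitian hHB α n x) fun s => if |s| < ε then 1 else 0
  rw [resonantPairs, resonantPairs, Finset.card_filter, Finset.card_filter, hF, Finset.mul_sum]
  refine Finset.sum_congr rfl fun q _ => ?_
  have h1 := not_lt.2 (hs q).1
  have h2 := not_lt.2 (hs q).2
  unfold energy at h1 h2 ⊢
  rw [if_neg h1, if_neg h2, add_zero, add_zero, smul_eq_mul]

theorem unperturbed_add_ne_zero {α : ℝ} {n : ℕ} {x : (ℕ → ℝ) × (ℕ → ℝ)}
    (h0 : ∀ q : _ × _, energy hHB α n x q.1 + energy hHB α n x q.2 ≠ 0)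
    (hs : ∀ q : _ × _, energy hHB α n x q.1 + energy hHB α n x q.2 + 2 * x.1 (n + 1) ≠ 0 ∧
      energy hHB α n x q.1 + energy hHB α n x q.2 - 2 * x.1 (n + 1) ≠ 0) (q : _ × _) :
    (unperturbed_isHermitian hHB α n x).eigenvalues₀ q.1
      + (unperturbed_isHermitian hHB α n x).eigenvalues₀ q.2 ≠ 0 := by
  have hF := sum_pair_embed (hamiltonian_isHermitian hHB α x.1 x.2 n) (x.1 (n + 1))
    (unperturbed_isHermitian hHB α n x) fun s => (if s = 0 then 1 else 0 : ℕ)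
  rw [Finset.sum_eq_zero (s := Finset.univ (α := Fin (Fintype.card (Config n)) × _))] at hF
  · have := (Finset.sum_eq_zero_iff.1 hF) q (Finset.mem_univ q)
    simpa using this
  · intro q _
    have h1 := h0 q
    have h2 := hs q
    unfold energy at h1 h2
    rw [if_neg h1, if_neg h2.1, if_neg h2.2, smul_zero, add_zero, add_zero]

/-- Adding one spin creates no vanishing sum of levels, for almost every coupling. -/
theorem ae_energy_succ_add_ne_zero {α : ℝ} {n : ℕ} (hn : nB ≤ n) {x : (ℕ → ℝ) × (ℕ → ℝ)}
    (h0 : ∀ q : _ × _, energy hHB α n x q.1 + energy hHB α n x q.2 ≠ 0)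
    (hs : ∀ q : _ × _, energy hHB α n x q.1 + energy hHB α n x q.2 + 2 * x.1 (n + 1) ≠ 0 ∧
      energy hHB α n x q.1 + energy hHB α n x q.2 - 2 * x.1 (n + 1) ≠ 0) :
    ∀ᵐ v : ℝ, ∀ q : _ × _,
      energy hHB α (n + 1) (x.1, Function.update x.2 (n + 1) v) q.1
        + energy hHB α (n + 1) (x.1, Function.update x.2 (n + 1) v) q.2 ≠ 0 := by
  set A := embed (hamiltonian HB α x.1 x.2 n) + ((x.1 (n + 1) : ℝ) : ℂ) • pauliZ (Fin.last n)
    with hA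
  set W := pauliX (n := n + 1) 0 * pauliX (Fin.last n) with hW
  -- The value at 0 is the product of the uncoupled pair sums, none of which vanishes. A nonzero
  -- polynomial excludes only finitely many couplings.
  have hp : kronPoly A (((α ^ (n + 1) : ℝ) : ℂ) • W) ≠ 0 := by
    intro h
    have h1 := eval_kronPoly A (((α ^ (n + 1) : ℝ) : ℂ) • W) 0
    rw [h, Polynomial.eval_zero, zero_smul, add_zero] at h1
    have h2 := norm_det_kronSum (unperturbed_isHermitian hHB α n x)
    obtain ⟨q, _, hq⟩ := Finset.prod_eq_zero_iff.1 (h2.symm.trans (norm_eq_zero.2 h1.symm))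
    exact unperturbed_add_ne_zero hHB h0 hs q (abs_eq_zero.1 hq)
  filter_upwards [ae_eval_ofReal_ne_zero hp] with v hv q
  rw [energy_succ_update hHB hn]
  rw [eval_kronPoly, smul_smul, ← Complex.ofReal_mul, mul_comm v] at hv
  have h2 := norm_det_kronSum (perturbed_isHermitian hHB α hn x v)
  rw [← norm_ne_zero_iff, h2] at hv
  exact abs_ne_zero.1 (Finset.prod_ne_zero_iff.1 hv q (Finset.mem_univ q))

section Step

variable {α θ : ℝ} (hθ : 2 / 3 < θ) (hθ' : θ < 1) (hα : 0 < α)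
  (hα' : α ≤ Real.exp (-(20 / (1 - θ)))) {n : ℕ} (hn : nB ≤ n)
  {x : (ℕ → ℝ) × (ℕ → ℝ)}
  (hs : Separated (threshold α θ n) (energy hHB α n x) (x.1 (n + 1)))

include hθ hθ' hα hα' hn hs

/-- The field doubles the count and the coupling adds no pair. This deterministic bound makes the
pair density monotone. -/
theorem card_resonantPairs_succ_le (hg : |x.2 (n + 1)| ≤ 1 / 2) :
    (resonantPairs (threshold α θ (n + 1)) (energy hHB α (n + 1) x)).card
      ≤ 2 * (resonantPairs (threshold α θ n) (energy hHB α n x)).card := by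
  rw [← card_resonantPairs_unperturbed hHB hs]
  have h1 := energy_succ_update hHB (α := α) hn x (x.2 (n + 1))
  rw [Function.update_eq_self] at h1
  rw [h1]
  exact Finset.card_le_card (resonantPairs_add_smul_subset (unperturbed_isHermitian hHB α n x)
    (pauliX_mul_pauliX_mem_unitaryGroup 0 (Fin.last n)) (pow_nonneg hα.le (n + 1))
    (threshold_succ_add_le hθ hθ' hα hα' n) (perturbed_isHermitian hHB α hn x) hg)

/-- The radii are R = 16^n, which dominates 4^(n+1) for n ≥ 1, and R' = 16^n e^(12n), so that
3/log(R'/R) = 1/(4n). The product of the factors 1 + 1/(4k) grows only like n^(1/4), slower than the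
minimal weight n of a pair. -/
theorem lintegral_potential_succ_le (hn1 : 1 ≤ n) :
    ∫⁻ v in Set.Icc (-1 / 2 : ℝ) (1 / 2), potential (threshold α θ (n + 1))
        (energy hHB α (n + 1) (x.1, Function.update x.2 (n + 1) v))
      ≤ ENNReal.ofReal (1 + 1 / (4 * n)) * (2 * potential (threshold α θ n) (energy hHB α n x))
        + 3 := by
  have hn1' : (1 : ℝ) ≤ n := by exact_mod_cast hn1
  have hcard : (Fintype.card (Config (n + 1)) : ℝ) ^ 2 = 4 ^ (n + 1) := by
    rw [card_config]; push_cast; rw [← pow_mul, mul_comm, pow_mul]; norm_num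
  have hL : Real.log ((16 : ℝ) ^ n * Real.exp (12 * n) / 16 ^ n) = 12 * n := by
    rw [mul_div_cancel_left₀ _ (by positivity), Real.log_exp]
  have hpert := perturbation_le_threshold hθ hθ' hα hα' n
  have hεpos := threshold_pos (θ := θ) hα n
  have hε := threshold_le_quarter hθ hθ' hα hα' n
  have key := lintegral_potential_add_smul_le (unperturbed_isHermitian hHB α n x)
    (pauliX_mul_pauliX_mem_unitaryGroup 0 (Fin.last n)) (pow_nonneg hα.le (n + 1))
    (threshold_succ_add_le hθ hθ' hα hα' n) (perturbed_isHermitian hHB α hn x)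
    hεpos (R := 16 ^ n) (R' := 16 ^ n * Real.exp (12 * n)) (by
      rw [hcard]
      obtain ⟨m, rfl⟩ : ∃ m, n = m + 1 := ⟨n - 1, by omega⟩
      calc (4 : ℝ) ^ (m + 1 + 1) = 16 * 4 ^ m := by ring
        _ ≤ 16 * 16 ^ m := by gcongr; norm_num
        _ = _ := by ring) (by
      refine lt_mul_of_one_lt_right (by positivity) (Real.one_lt_exp_iff.2 (by linarith)))
      (by rw [hL]; linarith) (by
        rw [hcard]
        have h4 : (1 : ℝ) ≤ 4 ^ (n + 1) := one_le_pow₀ (by norm_num)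
        have h5 : 2 * 4 ^ (n + 1) * (16 ^ n * Real.exp (12 * n) * α ^ (n + 1))
            ≤ (4 : ℝ) ^ (n + 1) * (2 * 4 ^ (n + 1) * (16 ^ n * Real.exp (12 * n) * α ^ (n + 1))) :=
          le_mul_of_one_le_left (by positivity) h4
        linarith) (by
        rw [hcard, mul_div_assoc', div_le_one hεpos]
        exact hpert)
  rw [hL, potential_unperturbed hHB hs] at key
  have h3 : (3 : ℝ) / (12 * n) = 1 / (4 * n) := by
    rw [div_eq_div_iff (by positivity) (by positivity)]; ring
  rw [h3] at key
  simp only [energy_succ_update hHB hn]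
  exact key

end Step

end Model

end QuantumSun

end

/-! ### Probability: independence, measurability and null sets of the disorder. -/

noncomputable section

namespace QuantumSun

open scoped ENNReal

section Independence

variable {Ω : Type*} [MeasurableSpace Ω] {P : Measure Ω} [IsProbabilityMeasure P]
  {X : Type*} [MeasurableSpace X] {U : Ω → X} {V : Ω → ℝ}

/-- Tonelli for the product law of (U, V). The interval has length 1, so the uniform law is Lebesgue
measure without a constant. -/
theorem lintegral_comp_eq_of_isUniform (hU : Measurable U) (hV : Measurable V)
    (hUV : IndepFun U V P) (hVu : pdf.IsUniform V (Set.Icc (-1 / 2 : ℝ) (1 / 2)) P)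
    {F : X × ℝ → ℝ≥0∞} (hF : Measurable F) :
    ∫⁻ ω, F (U ω, V ω) ∂P 
      = ∫⁻ ω, (∫⁻ v in Set.Icc (-1 / 2 : ℝ) (1 / 2), F (U ω, v)) ∂P := by
  have hmap : P.map V = volume.restrict (Set.Icc (-1 / 2 : ℝ) (1 / 2)) := by
    rw [hVu, ProbabilityTheory.cond, Real.volume_Icc]
    norm_num
  have h1 := (indepFun_iff_map_prod_eq_prod_map_map hU.aemeasurable hV.aemeasurable).1 hUV
  have : IsProbabilityMeasure (P.map U) := Measure.isProbabilityMeasure_map hU.aemeasurable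
  rw [← lintegral_map hF (hU.prodMk hV), h1, hmap, lintegral_prod _ hF.aemeasurable,
    lintegral_map hF.lintegral_prod_right' hU]

theorem measure_le_of_section_le (hU : Measurable U) (hV : Measurable V)
    (hUV : IndepFun U V P) (hVu : pdf.IsUniform V (Set.Icc (-1 / 2 : ℝ) (1 / 2)) P)
    {B : Set (X × ℝ)} (hB : MeasurableSet B) {c : ℝ≥0∞}
    (hc : ∀ u, volume {v | (u, v) ∈ B} ≤ c) : P {ω | (U ω, V ω) ∈ B} ≤ c := by
  have h1 : P {ω | (U ω, V ω) ∈ B} = ∫⁻ ω, B.indicator 1 (U ω, V ω) ∂P := by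
    have h2 : MeasurableSet {ω | (U ω, V ω) ∈ B} := (hU.prodMk hV) hB
    rw [← lintegral_indicator_one h2]
    rfl
  rw [h1, lintegral_comp_eq_of_isUniform hU hV hUV hVu (measurable_one.indicator hB)]
  calc _ ≤ ∫⁻ _, c ∂P := by
        refine lintegral_mono fun ω => ?_
        refine (setLIntegral_le_lintegral _ _).trans ?_
        have h2 : MeasurableSet {v | (U ω, v) ∈ B} := measurable_prodMk_left hB
        refine le_trans (le_of_eq ?_) (hc (U ω))
        rw [← lintegral_indicator_one h2]
        rfl
    _ = c := by simp

theorem ae_notMem_of_section_null (hU : Measurable U) (hV : Measurable V)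
    (hUV : IndepFun U V P) (hVu : pdf.IsUniform V (Set.Icc (-1 / 2 : ℝ) (1 / 2)) P)
    {B : Set (X × ℝ)} (hB : MeasurableSet B) (hc : ∀ u, ∀ᵐ v : ℝ, (u, v) ∉ B) :
    ∀ᵐ ω ∂P, (U ω, V ω) ∉ B := by
  rw [ae_iff]
  simp only [not_not]
  refine le_antisymm (measure_le_of_section_le hU hV hUV hVu hB fun u => ?_) zero_le
  have := hc u
  rw [ae_iff] at this
  simpa using this.le

end Independence

section Disorder

variable {Ω : Type*} [MeasurableSpace Ω] {P : Measure Ω} {nB : ℕ} {h g : ℕ → Ω → ℝ}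

/-- The disorder variables `h_i`, `i ≤ a`, and `g_i`, `i ≤ b`. -/
def truncation (nB : ℕ) (h g : ℕ → Ω → ℝ) (a b : ℕ) (ω : Ω) : (ℕ → ℝ) × (ℕ → ℝ) :=
  (fun i => if nB < i ∧ i ≤ a then h i ω else 0, fun i => if nB < i ∧ i ≤ b then g i ω else 0)

theorem measurable_truncation (hD : IsDisorder P nB h g) (a b : ℕ) :
    Measurable (truncation nB h g a b) := by
  refine Measurable.prodMk (measurable_pi_lambda _ fun i => ?_) (measurable_pi_lambda _ fun i => ?_)
  · by_cases hi : nB < i ∧ i ≤ a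
    · simpa only [hi, and_self, if_true] using hD.measurable_h i hi.1
    · simp only [hi, if_false]; exact measurable_const
  · by_cases hi : nB < i ∧ i ≤ b
    · simpa only [hi, and_self, if_true] using hD.measurable_g i hi.1
    · simp only [hi, if_false]; exact measurable_const

/-- Entries outside the window are set to 0, so the truncation is a measurable function of finitely
many disorder variables, none of which is the j-th. -/
theorem indepFun_truncation (hD : IsDisorder P nB h g) (a b : ℕ)
    (j : {i : ℕ // nB < i} ⊕ {i : ℕ // nB < i})
    (hj : j ∉ ((Finset.Iic a).subtype (nB < ·)).disjSum ((Finset.Iic b).subtype (nB < ·))) :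
    IndepFun (truncation nB h g a b) (Sum.elim (fun i => h i.1) (fun i => g i.1) j) P := by
  set S := ((Finset.Iic a).subtype (nB < ·)).disjSum ((Finset.Iic b).subtype (nB < ·)) with hS
  have hmeas : ∀ k : {i : ℕ // nB < i} ⊕ {i : ℕ // nB < i},
      Measurable (Sum.elim (fun i => h i.1) (fun i => g i.1) k) := by
    rintro (i | i)
    · exact hD.measurable_h i i.2
    · exact hD.measurable_g i i.2
  have key := hD.indep.indepFun_finset S {j} (Finset.disjoint_singleton_right.2 hj) hmeas
  have hl (i : ℕ) (hi : nB < i ∧ i ≤ a) : (Sum.inl ⟨i, hi.1⟩ : _ ⊕ {i : ℕ // nB < i}) ∈ S := by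
    simp [hS, hi.2]
  have hr (i : ℕ) (hi : nB < i ∧ i ≤ b) : (Sum.inr ⟨i, hi.1⟩ : {i : ℕ // nB < i} ⊕ _) ∈ S := by
    simp [hS, hi.2]
  let φ : (S → ℝ) → (ℕ → ℝ) × (ℕ → ℝ) := fun t =>
    (fun i => if hi : nB < i ∧ i ≤ a then t ⟨_, hl i hi⟩ else 0,
      fun i => if hi : nB < i ∧ i ≤ b then t ⟨_, hr i hi⟩ else 0)
  have hφ : Measurable φ := by
    refine Measurable.prodMk (measurable_pi_lambda _ fun i => ?_)
      (measurable_pi_lambda _ fun i => ?_)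
    · by_cases hi : nB < i ∧ i ≤ a
      · simp only [hi, and_self, dif_pos]; exact measurable_pi_apply _
      · simp only [hi, dif_neg, not_false_eq_true]; exact measurable_const
    · by_cases hi : nB < i ∧ i ≤ b
      · simp only [hi, and_self, dif_pos]; exact measurable_pi_apply _
      · simp only [hi, dif_neg, not_false_eq_true]; exact measurable_const
  exact key.comp hφ (measurable_pi_apply (⟨j, Finset.mem_singleton_self j⟩ : ({j} : Finset _)))

theorem indepFun_truncation_h (hD : IsDisorder P nB h g) {n : ℕ} (hn : nB ≤ n) :
    IndepFun (truncation nB h g n n) (h (n + 1)) P :=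
  indepFun_truncation hD n n (Sum.inl ⟨n + 1, by omega⟩) (by simp)

/-- The field h_{n+1} belongs to the past of g_{n+1}: separation at step n is decided before the
coupling is averaged. -/
theorem indepFun_truncation_g (hD : IsDisorder P nB h g) {n : ℕ} (hn : nB ≤ n) :
    IndepFun (truncation nB h g (n + 1) n) (g (n + 1)) P :=
  indepFun_truncation hD (n + 1) n (Sum.inr ⟨n + 1, by omega⟩) (by simp)

/-- A realisation of the disorder. -/
def realisation (h g : ℕ → Ω → ℝ) (ω : Ω) : (ℕ → ℝ) × (ℕ → ℝ) := (fun i => h i ω, fun i => g i ω)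

variable {HB : Matrix (Config nB) (Config nB) ℂ} (hHB : HB.IsHermitian) {α : ℝ}

omit [MeasurableSpace Ω] in
theorem energy_truncation {n a b : ℕ} (ha : n ≤ a) (hb : n ≤ b) (ω : Ω) :
    energy hHB α n (truncation nB h g a b ω) = energy hHB α n (realisation h g ω) :=
  energy_congr hHB (fun _ h1 h2 => if_pos ⟨h1, h2.trans ha⟩)
    (fun _ h1 h2 => if_pos ⟨h1, h2.trans hb⟩)

omit [MeasurableSpace Ω] in
theorem energy_succ_truncation {n : ℕ} (ω : Ω) :
    energy hHB α (n + 1) ((truncation nB h g (n + 1) n ω).1,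
        Function.update (truncation nB h g (n + 1) n ω).2 (n + 1) (g (n + 1) ω))
      = energy hHB α (n + 1) (realisation h g ω) := by
  refine energy_congr hHB (fun _ h1 h2 => if_pos ⟨h1, h2⟩) fun i h1 h2 => ?_
  rcases eq_or_ne i (n + 1) with rfl | hi
  · simp [realisation]
  · simp only [Function.update_of_ne hi, realisation, truncation]
    rw [if_pos ⟨h1, by omega⟩]

omit [MeasurableSpace Ω] in
theorem truncation_fst_succ {n b : ℕ} (hn : nB ≤ n) (ω : Ω) :
    (truncation nB h g (n + 1) b ω).1 (n + 1) = h (n + 1) ω :=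
  if_pos ⟨by omega, le_rfl⟩

theorem measurable_energy (α : ℝ) (n : ℕ) (i : Fin (Fintype.card (Config n))) :
    Measurable fun x => energy hHB α n x i :=
  (continuous_energy hHB α n i).measurable

theorem measurable_potential (α ε : ℝ) (n : ℕ) :
    Measurable fun x => potential ε (energy hHB α n x) :=
  Finset.measurable_sum _ fun q _ => (measurable_logWeight ε).comp
    ((measurable_energy hHB α n q.1).add (measurable_energy hHB α n q.2))

theorem measurable_card_resonantPairs (α ε : ℝ) (n : ℕ) :
    Measurable fun x => ((resonantPairs ε (energy hHB α n x)).card : ℝ≥0∞) := by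
  simp only [resonantPairs, Finset.card_filter, Nat.cast_sum]
  refine Finset.measurable_sum _ fun q _ => ?_
  have h1 : MeasurableSet {x | |energy hHB α n x q.1 + energy hHB α n x q.2| < ε} :=
    measurableSet_lt ((measurable_energy hHB α n q.1).add (measurable_energy hHB α n q.2)).norm
      measurable_const
  push_cast
  exact Measurable.ite h1 measurable_const measurable_const

/-- The function `(x, v) ↦` the disorder `x` with `g_m` replaced by `v`. -/
theorem measurable_update_snd (m : ℕ) :
    Measurable fun y : ((ℕ → ℝ) × (ℕ → ℝ)) × ℝ => (y.1.1, Function.update y.1.2 m y.2) := by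
  refine Measurable.prodMk (by fun_prop) (measurable_pi_lambda _ fun i => ?_)
  rcases eq_or_ne i m with rfl | hi
  · simp only [Function.update_self]; fun_prop
  · simp only [Function.update_of_ne hi]; fun_prop

theorem measurableSet_separated (α ε : ℝ) (n : ℕ) :
    MeasurableSet {y : ((ℕ → ℝ) × (ℕ → ℝ)) × ℝ | Separated ε (energy hHB α n y.1) y.2} := by
  simp only [Separated, Set.ofPred_forall]
  refine MeasurableSet.iInter fun q => ?_
  have h1 : Measurable fun y : ((ℕ → ℝ) × (ℕ → ℝ)) × ℝ =>
      energy hHB α n y.1 q.1 + energy hHB α n y.1 q.2 :=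
    ((measurable_energy hHB α n q.1).comp measurable_fst).add
      ((measurable_energy hHB α n q.2).comp measurable_fst)
  have h2 : Measurable fun y : ((ℕ → ℝ) × (ℕ → ℝ)) × ℝ => 2 * y.2 :=
    measurable_snd.const_mul 2
  exact (measurableSet_le measurable_const (h1.add h2).norm).inter
    (measurableSet_le measurable_const (h1.sub h2).norm)

/-- Each pair sum excludes two open intervals of t, each of length ε when ε ≥ 0. -/
theorem volume_not_separated_le {κ : Type*} [Fintype κ] (ε : ℝ) (a : κ → ℝ) :
    volume {t : ℝ | ¬ Separated ε a t}
      ≤ (Fintype.card κ : ℝ≥0∞) ^ 2 * (2 * ENNReal.ofReal ε) := by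
  have hsub : {t : ℝ | ¬ Separated ε a t} ⊆ ⋃ q : κ × κ,
      (Set.Ioo ((-ε - (a q.1 + a q.2)) / 2) ((ε - (a q.1 + a q.2)) / 2)
        ∪ Set.Ioo ((-ε + (a q.1 + a q.2)) / 2) ((ε + (a q.1 + a q.2)) / 2)) := by
    intro t ht
    simp only [Separated, Set.mem_ofPred_eq, not_forall, not_and_or, not_le] at ht
    obtain ⟨q, hq⟩ := ht
    refine Set.mem_iUnion.2 ⟨q, ?_⟩
    rcases hq with hq | hq
    · left
      rw [abs_lt] at hq
      constructor <;> linarith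
    · right
      rw [abs_lt] at hq
      constructor <;> linarith
  refine (measure_mono hsub).trans ((measure_iUnion_fintype_le _ _).trans ?_)
  calc _ ≤ ∑ _q : κ × κ, 2 * ENNReal.ofReal ε := by
        refine Finset.sum_le_sum fun q _ => (measure_union_le _ _).trans ?_
        rw [Real.volume_Ioo, Real.volume_Ioo, two_mul]
        refine add_le_add ?_ ?_ <;> refine ENNReal.ofReal_le_ofReal (le_of_eq (by ring))
    _ = _ := by
        simp [sq]

variable [IsProbabilityMeasure P]

theorem measure_not_separated_le (hD : IsDisorder P nB h g) {n : ℕ} (hn : nB ≤ n) (ε : ℝ) :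
    P {ω | ¬ Separated ε (energy hHB α n (realisation h g ω)) (h (n + 1) ω)}
      ≤ (4 : ℝ≥0∞) ^ n * (2 * ENNReal.ofReal ε) := by
  have key := measure_le_of_section_le (measurable_truncation hD n n)
    (hD.measurable_h (n + 1) (by omega)) (indepFun_truncation_h hD hn)
    (hD.uniform_h (n + 1) (by omega)) (measurableSet_separated hHB α ε n).compl
    (c := (4 : ℝ≥0∞) ^ n * (2 * ENNReal.ofReal ε)) (fun u => by
      refine (volume_not_separated_le ε (energy hHB α n u)).trans_eq ?_
      rw [Fintype.card_fin, card_config]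
      push_cast
      rw [← pow_mul, mul_comm n, pow_mul]
      norm_num)
  simpa only [Set.mem_compl_iff, Set.mem_ofPred_eq, energy_truncation hHB le_rfl le_rfl] using key

/-- Almost surely no sum of two levels vanishes. -/
theorem ae_energy_add_ne_zero (hHB' : IsNondegenerateBath hHB) (hD : IsDisorder P nB h g) {n : ℕ}
    (hn : nB ≤ n) : ∀ᵐ ω ∂P, ∀ q : _ × _, energy hHB α n (realisation h g ω) q.1
      + energy hHB α n (realisation h g ω) q.2 ≠ 0 := by
  induction n, hn using Nat.le_induction with
  | base =>
    refine Eventually.of_forall fun ω => ?_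
    have hham : hamiltonian HB α (realisation h g ω).1 (realisation h g ω).2 nB = HB := by
      have h1 : bathOp HB nB = HB := by
        ext σ τ
        have hb (σ : Config nB) : σ.bath nB = σ := by
          ext i
          simp [Config.bath]
        simp [bathOp, hb, not_le.2 (Fin.is_lt _)]
      rw [hamiltonian, h1, Finset.filter_false_of_mem fun j _ => not_le.2 j.2, Finset.sum_empty,
        add_zero]
    have hen : energy hHB α nB (realisation h g ω) = hHB.eigenvalues₀ :=
      eigenvalues₀_congr _ _ hham
    intro q
    rw [hen]
    have := hHB'.antigap (Fintype.equivOfCardEq (Fintype.card_fin _) q.1)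
      (Fintype.equivOfCardEq (Fintype.card_fin _) q.2)
    simp only [Matrix.IsHermitian.eigenvalues, Equiv.symm_apply_apply] at this
    exact abs_pos.1 this
  | succ n hn ih =>
    have hm (m : ℕ) : MeasurableSet
        {x | ∀ q : _ × _, energy hHB α m x q.1 + energy hHB α m x q.2 ≠ 0} := by
      simp only [Set.ofPred_forall]
      refine MeasurableSet.iInter fun q => ?_
      exact (measurableSet_eq_fun ((measurable_energy hHB α m q.1).add
        (measurable_energy hHB α m q.2)) measurable_const).compl
    have hs : MeasurableSet {y : ((ℕ → ℝ) × (ℕ → ℝ)) × ℝ | ∀ q : _ × _,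
        energy hHB α n y.1 q.1 + energy hHB α n y.1 q.2 + 2 * y.2 ≠ 0 ∧
        energy hHB α n y.1 q.1 + energy hHB α n y.1 q.2 - 2 * y.2 ≠ 0} := by
      simp only [Set.ofPred_forall]
      refine MeasurableSet.iInter fun q => ?_
      have h1 : Measurable fun y : ((ℕ → ℝ) × (ℕ → ℝ)) × ℝ =>
          energy hHB α n y.1 q.1 + energy hHB α n y.1 q.2 :=
        ((measurable_energy hHB α n q.1).comp measurable_fst).add
          ((measurable_energy hHB α n q.2).comp measurable_fst)
      have h2 : Measurable fun y : ((ℕ → ℝ) × (ℕ → ℝ)) × ℝ => 2 * y.2 :=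
        measurable_snd.const_mul 2
      exact (measurableSet_eq_fun (h1.add h2) measurable_const).compl.inter
        (measurableSet_eq_fun (h1.sub h2) measurable_const).compl
    have hfield := ae_notMem_of_section_null (measurable_truncation hD n n)
      (hD.measurable_h (n + 1) (by omega)) (indepFun_truncation_h hD hn)
      (hD.uniform_h (n + 1) (by omega)) hs.compl (fun u => by
        have : ∀ᵐ v : ℝ, ∀ q : Fin (Fintype.card (Config n)) × Fin (Fintype.card (Config n)),
            v ≠ -(energy hHB α n u q.1 + energy hHB α n u q.2) / 2 ∧
            v ≠ (energy hHB α n u q.1 + energy hHB α n u q.2) / 2 := by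
          rw [ae_all_iff]
          intro q
          exact (Measure.ae_ne volume _).and (Measure.ae_ne volume _)
        filter_upwards [this] with v hv
        simp only [Set.mem_compl_iff, not_not, Set.mem_ofPred_eq]
        refine fun q => ⟨fun h0 => (hv q).1 (by linarith), fun h0 => (hv q).2 (by linarith)⟩)
    set Q : Set ((ℕ → ℝ) × (ℕ → ℝ)) :=
      {x | ∀ q : _ × _, energy hHB α n x q.1 + energy hHB α n x q.2 ≠ 0} ∩
        {x | ∀ q : _ × _, energy hHB α n x q.1 + energy hHB α n x q.2 + 2 * x.1 (n + 1) ≠ 0 ∧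
          energy hHB α n x q.1 + energy hHB α n x q.2 - 2 * x.1 (n + 1) ≠ 0} with hQ
    have hQm : MeasurableSet Q := by
      refine (hm n).inter ?_
      have : Measurable fun x : (ℕ → ℝ) × (ℕ → ℝ) => (x, x.1 (n + 1)) := by fun_prop
      exact this hs
    -- The bad set contains only pasts in Q, so every section is null: finitely many couplings for a
    -- past in Q, none otherwise.
    have hcoup := ae_notMem_of_section_null (measurable_truncation hD (n + 1) n)
      (hD.measurable_g (n + 1) (by omega)) (indepFun_truncation_g hD hn)
      (hD.uniform_g (n + 1) (by omega))
      (B := Prod.fst ⁻¹' Q ∩ ((fun y : ((ℕ → ℝ) × (ℕ → ℝ)) × ℝ =>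
        (y.1.1, Function.update y.1.2 (n + 1) y.2)) ⁻¹'
          {x | ∀ q : _ × _, energy hHB α (n + 1) x q.1 + energy hHB α (n + 1) x q.2 ≠ 0}ᶜ))
      ((measurable_fst hQm).inter (measurable_update_snd (n + 1) (hm (n + 1)).compl))
      (fun u => by
        by_cases hu : u ∈ Q
        · filter_upwards [ae_energy_succ_add_ne_zero hHB hn hu.1 hu.2] with v hv hv'
          exact hv'.2 hv
        · exact Eventually.of_forall fun v hv => hu hv.1)
    filter_upwards [ih, hfield, hcoup] with ω h1 h2 h3
    simp only [Set.mem_compl_iff, not_not, Set.mem_ofPred_eq,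
      energy_truncation hHB le_rfl le_rfl] at h2
    by_contra h4
    refine h3 ⟨⟨?_, ?_⟩, ?_⟩
    · simpa only [Set.mem_ofPred_eq, energy_truncation hHB (Nat.le_succ n) le_rfl] using h1
    · simpa only [Set.mem_ofPred_eq, energy_truncation hHB (Nat.le_succ n) le_rfl,
        truncation_fst_succ hn] using h2
    · simpa only [Set.mem_preimage, Set.mem_compl_iff, Set.mem_ofPred_eq,
        energy_succ_truncation hHB] using h4

omit [IsProbabilityMeasure P] in
theorem ae_abs_g_le (hD : IsDisorder P nB h g) {i : ℕ} (hi : nB < i) :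
    ∀ᵐ ω ∂P, |g i ω| ≤ 1 / 2 := by
  have h1 := hD.uniform_g i hi
  have h2 : ∀ᵐ v ∂(P.map (g i)), v ∈ Set.Icc (-1 / 2 : ℝ) (1 / 2) := by
    rw [h1]
    exact ae_cond_mem measurableSet_Icc
  filter_upwards [ae_of_ae_map (hD.measurable_g i hi).aemeasurable h2] with ω hω
  exact abs_le.2 ⟨by linarith [hω.1], hω.2⟩

end Disorder

end QuantumSun

end

/-! ### Decay of the density of anti-resonant pairs. -/

noncomputable section

namespace QuantumSun

open scoped ENNReal

section Decay

variable {Ω : Type*} [MeasurableSpace Ω] {P : Measure Ω} {nB : ℕ} {h g : ℕ → Ω → ℝ}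
  {HB : Matrix (Config nB) (Config nB) ℂ} (hHB : HB.IsHermitian)

/-- The disorders with logarithmic weight at most `K` at `N` spins, for which no new anti-resonance
appears when the spins `N + 1, …, m` are added. -/
def controlled (α θ : ℝ) (N : ℕ) (K : ℝ≥0∞) (m : ℕ) : Set ((ℕ → ℝ) × (ℕ → ℝ)) :=
  {x | potential (threshold α θ N) (energy hHB α N x) ≤ K ∧ ∀ k, N ≤ k → k < m →
    Separated (threshold α θ k) (energy hHB α k x) (x.1 (k + 1))}

theorem measurableSet_controlled (α θ : ℝ) (N : ℕ) (K : ℝ≥0∞) (m : ℕ) :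
    MeasurableSet (controlled hHB α θ N K m) := by
  have hsep (k : ℕ) : MeasurableSet {x : (ℕ → ℝ) × (ℕ → ℝ) |
      Separated (threshold α θ k) (energy hHB α k x) (x.1 (k + 1))} := by
    have : Measurable fun x : (ℕ → ℝ) × (ℕ → ℝ) => (x, x.1 (k + 1)) := by fun_prop
    exact this (measurableSet_separated hHB α (threshold α θ k) k)
  refine (measurableSet_le (measurable_potential hHB α _ N) measurable_const).inter ?_
  have hInter : {x | ∀ k, N ≤ k → k < m →
        Separated (threshold α θ k) (energy hHB α k x) (x.1 (k + 1))}
      = ⋂ k, ⋂ (_ : N ≤ k), ⋂ (_ : k < m), {x : (ℕ → ℝ) × (ℕ → ℝ) |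
        Separated (threshold α θ k) (energy hHB α k x) (x.1 (k + 1))} := by
    ext x
    simp only [Set.mem_iInter, Set.mem_ofPred_eq]
  refine (congrArg MeasurableSet hInter).mpr ?_
  exact MeasurableSet.iInter fun k => MeasurableSet.iInter fun _ => MeasurableSet.iInter fun _ =>
    hsep k

omit [MeasurableSpace Ω] in
-- Control up to m involves separation at k < m, that is, fields up to h_m but couplings only up to
-- g_{m-1}. Hence m ≤ b + 1 suffices, and membership at n + 1 does not depend on g_{n+1}.
theorem truncation_mem_controlled_iff {α θ : ℝ} {N m a b : ℕ} {K : ℝ≥0∞} (hN : nB ≤ N)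
    (hNb : N ≤ b) (ha : m ≤ a) (hNa : N ≤ a) (hb : m ≤ b + 1) (ω : Ω) :
    truncation nB h g a b ω ∈ controlled hHB α θ N K m
      ↔ realisation h g ω ∈ controlled hHB α θ N K m := by
  simp only [controlled, Set.mem_ofPred_eq]
  rw [energy_truncation hHB hNa hNb]
  refine and_congr_right fun _ => forall_congr' fun k => forall_congr' fun hk =>
    forall_congr' fun hkm => ?_
  rw [energy_truncation hHB (by omega) (by omega)]
  have : (truncation nB h g a b ω).1 (k + 1) = (realisation h g ω).1 (k + 1) :=
    if_pos ⟨by omega, by omega⟩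
  rw [this]

theorem controlled_succ_subset (α θ : ℝ) (N : ℕ) (K : ℝ≥0∞) (m : ℕ) :
    controlled hHB α θ N K (m + 1) ⊆ controlled hHB α θ N K m :=
  fun _ hx => ⟨hx.1, fun k h1 h2 => hx.2 k h1 (h2.trans (Nat.lt_succ_self m))⟩

/-- The mean logarithmic weight of the anti-resonant pairs at `m` spins, on controlled disorders. -/
def meanPotential (P : Measure Ω) (h g : ℕ → Ω → ℝ) (α θ : ℝ) (N : ℕ) (K : ℝ≥0∞) (m : ℕ) :
    ℝ≥0∞ :=
  ∫⁻ ω, (controlled hHB α θ N K m).indicator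
    (fun x => potential (threshold α θ m) (energy hHB α m x)) (realisation h g ω) ∂P

/-- The increment √(n+1) - √n is at least 2/(5√n) = 1/(4√n) + 3/(20√n). The first part pays for the
factor 1 + 1/(4n), the second for the additive 3, since C ≥ 10 and √n ≤ 2^n. -/
theorem sqrt_recursion {n : ℕ} (hn : 1 ≤ n) {C : ℝ} (hC : 10 ≤ C) :
    (1 + 1 / (4 * n)) * (2 * (C * 2 ^ n * √n)) + 3 ≤ C * 2 ^ (n + 1) * √((n + 1 : ℕ) : ℝ) := by
  have hn1 : (1 : ℝ) ≤ n := by exact_mod_cast hn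
  set s := √(n : ℝ) with hs
  set t := √((n + 1 : ℕ) : ℝ) with ht
  have hs2 : s ^ 2 = n := Real.sq_sqrt (by linarith)
  have ht2 : t ^ 2 = n + 1 := by rw [ht, Real.sq_sqrt (by positivity)]; push_cast; ring
  have hs1 : 1 ≤ s := by rw [hs]; exact Real.one_le_sqrt.2 hn1
  have ht0 : 0 ≤ t := Real.sqrt_nonneg _
  have hts : t ≤ 3 / 2 * s := by nlinarith
  have hdiff : s + 2 / (5 * s) ≤ t := by
    have h1 : (t - s) * (t + s) = 1 := by nlinarith
    have h2 : 1 ≤ (t - s) * (5 / 2 * s) := by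
      have : 0 ≤ t - s := by
        by_contra hneg
        nlinarith
      nlinarith
    have h3 : 2 / (5 * s) ≤ t - s := by
      rw [div_le_iff₀ (by positivity)]; linarith
    linarith
  have hpow : s ≤ 2 ^ n := by
    have h1 : (n : ℝ) ≤ 2 ^ n := by exact_mod_cast Nat.lt_two_pow_self.le
    nlinarith
  have h4 : s / (4 * n) = 1 / (4 * s) := by
    rw [← hs2]; field_simp
  have h5 : 3 ≤ C * 2 ^ (n + 1) * (3 / (20 * s)) := by
    rw [mul_div_assoc', le_div_iff₀ (by positivity), pow_succ]
    nlinarith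
  have h6 : (1 + 1 / (4 * n)) * (2 * (C * 2 ^ n * s)) = C * 2 ^ (n + 1) * (s + 1 / (4 * s)) := by
    rw [← h4]; ring
  rw [h6]
  calc _ ≤ C * 2 ^ (n + 1) * (s + 1 / (4 * s)) + C * 2 ^ (n + 1) * (3 / (20 * s)) := by gcongr
    _ = C * 2 ^ (n + 1) * (s + 2 / (5 * s)) := by field_simp; ring
    _ ≤ _ := by gcongr

variable [IsProbabilityMeasure P] {α θ : ℝ} (hθ : 2 / 3 < θ) (hθ' : θ < 1) (hα : 0 < α)
  (hα' : α ≤ Real.exp (-(20 / (1 - θ)))) (hD : IsDisorder P nB h g)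

include hθ hθ' hα hα' hD

/-- The controlled event at n + 1 is independent of g_{n+1}, so this coupling is integrated first
with the event fixed. On the event, separation at n holds and the one-step estimate applies. -/
theorem meanPotential_succ_le {N n : ℕ} {K : ℝ≥0∞} (hN : nB ≤ N) (hn : N ≤ n) (hn1 : 1 ≤ n) :
    meanPotential hHB P h g α θ N K (n + 1)
      ≤ ENNReal.ofReal (1 + 1 / (4 * n)) * (2 * meanPotential hHB P h g α θ N K n) + 3 := by
  let G : ((ℕ → ℝ) × (ℕ → ℝ)) × ℝ → ℝ≥0∞ := (Prod.fst ⁻¹' controlled hHB α θ N K (n + 1)).indicator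
    fun y => potential (threshold α θ (n + 1))
      (energy hHB α (n + 1) (y.1.1, Function.update y.1.2 (n + 1) y.2))
  have hG : Measurable G := ((measurable_potential hHB α _ (n + 1)).comp
    (measurable_update_snd (n + 1))).indicator
      (measurable_fst (measurableSet_controlled hHB α θ N K (n + 1)))
  have hGmem (u v) (hu : u ∈ controlled hHB α θ N K (n + 1)) : G (u, v)
      = potential (threshold α θ (n + 1))
        (energy hHB α (n + 1) (u.1, Function.update u.2 (n + 1) v)) :=
    Set.indicator_of_mem (s := Prod.fst ⁻¹' controlled hHB α θ N K (n + 1)) (a := (u, v)) hu _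
  have hGnotMem (u v) (hu : u ∉ controlled hHB α θ N K (n + 1)) : G (u, v) = 0 :=
    Set.indicator_of_notMem (s := Prod.fst ⁻¹' controlled hHB α θ N K (n + 1)) (a := (u, v)) hu _
  have h1 : meanPotential hHB P h g α θ N K (n + 1)
      = ∫⁻ ω, G (truncation nB h g (n + 1) n ω, g (n + 1) ω) ∂P := by
    refine lintegral_congr fun ω => ?_
    have hiff := truncation_mem_controlled_iff (h := h) (g := g) hHB (α := α) (θ := θ) (K := K) hN hn
      (le_refl (n + 1)) (by omega) (le_refl (n + 1)) ω
    by_cases hc : realisation h g ω ∈ controlled hHB α θ N K (n + 1)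
    · rw [Set.indicator_of_mem hc, hGmem _ _ (hiff.2 hc),
        energy_succ_truncation hHB]
    · rw [Set.indicator_of_notMem hc, hGnotMem _ _ fun h' => hc (hiff.1 h')]
  rw [h1, lintegral_comp_eq_of_isUniform (measurable_truncation hD (n + 1) n)
    (hD.measurable_g (n + 1) (by omega)) (indepFun_truncation_g hD (hN.trans hn))
    (hD.uniform_g (n + 1) (by omega)) hG]
  calc _ ≤ ∫⁻ ω, (ENNReal.ofReal (1 + 1 / (4 * n)) * (2 * (controlled hHB α θ N K n).indicator
          (fun x => potential (threshold α θ n) (energy hHB α n x)) (realisation h g ω)) + 3) ∂P := by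
        refine lintegral_mono fun ω => ?_
        by_cases hc : truncation nB h g (n + 1) n ω ∈ controlled hHB α θ N K (n + 1)
        · have h2 := (truncation_mem_controlled_iff hHB hN hn (Nat.le_succ n) (by omega)
            (Nat.le_succ n) ω).1 (controlled_succ_subset hHB α θ N K n hc)
          have key := lintegral_potential_succ_le hHB hθ hθ' hα hα' (hN.trans hn)
            (hc.2 n hn (Nat.lt_succ_self n)) hn1
          rw [energy_truncation hHB (Nat.le_succ n) le_rfl] at key
          rw [Set.indicator_of_mem h2]
          refine le_trans (le_of_eq ?_) key
          refine lintegral_congr fun v => ?_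
          exact hGmem _ _ hc
        · have h3 : ∀ v, G (truncation nB h g (n + 1) n ω, v) = 0 := fun v =>
            hGnotMem _ _ hc
          simp [h3]
    _ = _ := by
        rw [lintegral_add_right _ measurable_const, lintegral_const_mul' _ _ ENNReal.ofReal_ne_top,
          lintegral_const_mul' _ _ ENNReal.ofNat_ne_top, lintegral_const, measure_univ, mul_one]
        rfl

theorem meanPotential_le {N K : ℕ} (hN : nB ≤ N) (hN1 : 1 ≤ N) {n : ℕ} (hn : N ≤ n) :
    meanPotential hHB P h g α θ N K n ≤ ENNReal.ofReal (max 10 (K : ℝ) * 2 ^ n * √n) := by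
  induction n, hn using Nat.le_induction with
  | base =>
    calc meanPotential hHB P h g α θ N K N ≤ ∫⁻ _, (K : ℝ≥0∞) ∂P := by
          refine lintegral_mono fun ω => ?_
          by_cases hc : realisation h g ω ∈ controlled hHB α θ N K N
          · rw [Set.indicator_of_mem hc]
            exact hc.1
          · rw [Set.indicator_of_notMem hc]
            exact zero_le
      _ = ENNReal.ofReal K := by simp
      _ ≤ _ := by
          refine ENNReal.ofReal_le_ofReal ?_
          have h1 : (1 : ℝ) ≤ √N := Real.one_le_sqrt.2 (by exact_mod_cast hN1)
          have h2 : (1 : ℝ) ≤ 2 ^ N := one_le_pow₀ (by norm_num)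
          have h3 : (K : ℝ) ≤ max 10 (K : ℝ) := le_max_right _ _
          calc (K : ℝ) ≤ max 10 (K : ℝ) * 1 * 1 := by linarith
            _ ≤ _ := by gcongr
  | succ n hn ih =>
    refine (meanPotential_succ_le hHB hθ hθ' hα hα' hD hN hn (hN1.trans hn)).trans ?_
    calc _ ≤ ENNReal.ofReal (1 + 1 / (4 * n))
          * (2 * ENNReal.ofReal (max 10 (K : ℝ) * 2 ^ n * √n)) + 3 := by gcongr
      _ = ENNReal.ofReal ((1 + 1 / (4 * n)) * (2 * (max 10 (K : ℝ) * 2 ^ n * √n)) + 3) := by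
          have hC : 0 ≤ max 10 (K : ℝ) * 2 ^ n * √n := by positivity
          have hc : (0 : ℝ) ≤ 1 + 1 / (4 * n) := by positivity
          generalize max 10 (K : ℝ) * 2 ^ n * √n = C at hC
          generalize (1 + 1 / (4 * n) : ℝ) = c at hc
          rw [ENNReal.ofReal_add (by positivity) (by norm_num), ENNReal.ofReal_mul hc,
            ENNReal.ofReal_mul (by norm_num), ENNReal.ofReal_ofNat, ENNReal.ofReal_ofNat]
      _ ≤ _ := ENNReal.ofReal_le_ofReal (sqrt_recursion (hN1.trans hn) (le_max_left _ _))

/-- The density of anti-resonant pairs at `n` spins. -/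
def pairDensity (α θ : ℝ) (n : ℕ) (x : (ℕ → ℝ) × (ℕ → ℝ)) : ℝ≥0∞ :=
  ((resonantPairs (threshold α θ n) (energy hHB α n x)).card : ℝ≥0∞) * ENNReal.ofReal ((2 ^ n)⁻¹)

/-- Every pair below the threshold weighs at least n, so the mean density is at most the mean weight
divided by n 2^n. -/
theorem lintegral_pairDensity_le {N K : ℕ} (hN : nB ≤ N) (hN1 : 1 ≤ N) {n : ℕ} (hn : N ≤ n) :
    ∫⁻ ω, (controlled hHB α θ N K n).indicator (pairDensity hHB α θ n) (realisation h g ω) ∂P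
      ≤ ENNReal.ofReal (max 10 (K : ℝ) * (√n)⁻¹) := by
  have hn0 : (0 : ℝ) < n := by exact_mod_cast (hN1.trans hn)
  calc _ ≤ ∫⁻ ω, ENNReal.ofReal (((n : ℝ) * 2 ^ n)⁻¹) * (controlled hHB α θ N K n).indicator
          (fun x => potential (threshold α θ n) (energy hHB α n x)) (realisation h g ω) ∂P := by
        refine lintegral_mono fun ω => ?_
        by_cases hc : realisation h g ω ∈ controlled hHB α θ N K n
        · rw [Set.indicator_of_mem hc, Set.indicator_of_mem hc, pairDensity]
          calc _ = ENNReal.ofReal (((n : ℝ) * 2 ^ n)⁻¹)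
                * (((resonantPairs (threshold α θ n)
                  (energy hHB α n (realisation h g ω))).card : ℝ≥0∞) * ENNReal.ofReal n) := by
                rw [mul_left_comm, ← ENNReal.ofReal_mul (by positivity)]
                congr 2
                field_simp
            _ ≤ _ := by
                gcongr
                refine le_trans ?_ card_resonantPairs_mul_le
                gcongr
                exact le_neg_log_threshold hθ hθ' hα hα' n
        · rw [Set.indicator_of_notMem hc, Set.indicator_of_notMem hc]
          exact zero_le
    _ = ENNReal.ofReal (((n : ℝ) * 2 ^ n)⁻¹) * meanPotential hHB P h g α θ N K n := by
        rw [lintegral_const_mul' _ _ ENNReal.ofReal_ne_top]; rfl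
    _ ≤ ENNReal.ofReal (((n : ℝ) * 2 ^ n)⁻¹) * ENNReal.ofReal (max 10 (K : ℝ) * 2 ^ n * √n) := by
        gcongr
        exact meanPotential_le hHB hθ hθ' hα hα' hD hN hN1 hn
    _ = _ := by
        rw [← ENNReal.ofReal_mul (by positivity)]
        congr 1
        have h1 : √(n : ℝ) * √n = n := Real.mul_self_sqrt hn0.le
        have h2 : 0 < √(n : ℝ) := Real.sqrt_pos.2 hn0
        field_simp
        nlinarith

/-- The means tend to 0, and Fatou's lemma passes this to the pointwise liminf. The rate 1/√n is not
summable, so the full limit has to come from monotonicity. -/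
theorem ae_liminf_pairDensity_eq_zero {N : ℕ} (K : ℕ) (hN : nB ≤ N) (hN1 : 1 ≤ N) :
    ∀ᵐ ω ∂P, liminf (fun n => (controlled hHB α θ N K (n + N)).indicator
      (pairDensity hHB α θ (n + N)) (realisation h g ω)) atTop = 0 := by
  have hmeas (n : ℕ) : Measurable fun ω => (controlled hHB α θ N K (n + N)).indicator
      (pairDensity hHB α θ (n + N)) (realisation h g ω) := by
    have h1 : Measurable ((controlled hHB α θ N K (n + N)).indicator
        (pairDensity hHB α θ (n + N))) :=
      ((measurable_card_resonantPairs hHB α _ (n + N)).mul_const _).indicator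
        (measurableSet_controlled hHB α θ N K (n + N))
    have h2 := h1.comp (measurable_truncation hD (n + N) (n + N))
    convert h2 using 1
    ext ω
    have hiff := truncation_mem_controlled_iff (h := h) (g := g) hHB (α := α) (θ := θ)
      (K := (K : ℝ≥0∞)) hN (Nat.le_add_left N n)
      (le_refl (n + N)) (Nat.le_add_left N n) (Nat.le_succ (n + N)) ω
    rw [Function.comp_apply]
    by_cases hc : realisation h g ω ∈ controlled hHB α θ N K (n + N)
    · rw [Set.indicator_of_mem hc, Set.indicator_of_mem (hiff.2 hc), pairDensity, pairDensity,
        energy_truncation hHB le_rfl le_rfl]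
    · rw [Set.indicator_of_notMem hc, Set.indicator_of_notMem (fun h' => hc (hiff.1 h'))]
  have hlim : Tendsto (fun n : ℕ => ∫⁻ ω, (controlled hHB α θ N K (n + N)).indicator
      (pairDensity hHB α θ (n + N)) (realisation h g ω) ∂P) atTop (𝓝 0) := by
    have h1 : Tendsto (fun n : ℕ => ENNReal.ofReal (max 10 (K : ℝ) * (√((n + N : ℕ) : ℝ))⁻¹))
        atTop (𝓝 0) := by
      rw [← ENNReal.ofReal_zero]
      refine ENNReal.tendsto_ofReal ?_
      rw [← mul_zero (max 10 (K : ℝ))]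
      refine Tendsto.const_mul _ (tendsto_inv_atTop_zero.comp (Real.tendsto_sqrt_atTop.comp
        (tendsto_natCast_atTop_atTop.comp (tendsto_add_atTop_nat N))))
    exact tendsto_of_tendsto_of_tendsto_of_le_of_le tendsto_const_nhds h1 (fun _ => zero_le)
      fun n => lintegral_pairDensity_le hHB hθ hθ' hα hα' hD hN hN1 (Nat.le_add_left N n)
  have hfatou := (lintegral_liminf_le hmeas (μ := P)).trans hlim.liminf_eq.le
  have hliminf : Measurable fun ω => liminf (fun n => (controlled hHB α θ N K (n + N)).indicator
      (pairDensity hHB α θ (n + N)) (realisation h g ω)) atTop :=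
    Measurable.liminf hmeas
  have h2 := (lintegral_eq_zero_iff hliminf).1 (le_antisymm hfatou zero_le)
  filter_upwards [h2] with ω hω
  exact hω

/-- Borel–Cantelli: separation at n fails with probability at most 4^n · 2ε_n, and ε_n ≤ 8^(-n)/4.
-/
theorem ae_eventually_separated : ∀ᵐ ω ∂P, ∀ᶠ n in atTop,
    Separated (threshold α θ n) (energy hHB α n (realisation h g ω)) (h (n + 1) ω) := by
  have hsum : ∑' k, P {ω | ¬ Separated (threshold α θ (k + nB))
      (energy hHB α (k + nB) (realisation h g ω)) (h (k + nB + 1) ω)} ≠ ⊤ := by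
    refine ne_top_of_le_ne_top (b := ∑' k : ℕ, (2⁻¹ : ℝ≥0∞) ^ k) ?_ (ENNReal.tsum_le_tsum fun k => ?_)
    · rw [ENNReal.tsum_geometric]
      simp
    · refine (measure_not_separated_le hHB hD (Nat.le_add_left nB k) _).trans ?_
      have h1 := threshold_le hθ hθ' hα hα' (k + nB)
      have e8 : Real.exp (-40) ≤ 1 / 8 := by
        rw [Real.exp_neg, one_div]
        have := Real.add_one_le_exp 40
        gcongr
        linarith
      have h2 : threshold α θ (k + nB) ≤ (1 / 8) ^ (k + nB) / 4 := by
        refine h1.trans ?_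
        rw [mul_comm, Real.exp_nat_mul]
        gcongr
      have h3 : (4 : ℝ) ^ (k + nB) * (2 * ((1 / 8) ^ (k + nB) / 4)) ≤ (1 / 2) ^ k := by
        have : (4 : ℝ) ^ (k + nB) * (1 / 8) ^ (k + nB) = (1 / 2) ^ k * (1 / 2) ^ nB := by
          rw [← mul_pow, ← pow_add]; norm_num
        have h4 : ((1 : ℝ) / 2) ^ nB ≤ 1 := pow_le_one₀ (by norm_num) (by norm_num)
        have h5 : (0 : ℝ) < (1 / 2) ^ k := by positivity
        nlinarith
      calc (4 : ℝ≥0∞) ^ (k + nB) * (2 * ENNReal.ofReal (threshold α θ (k + nB)))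
          = ENNReal.ofReal (4 ^ (k + nB) * (2 * threshold α θ (k + nB))) := by
            rw [ENNReal.ofReal_mul (by positivity), ENNReal.ofReal_mul (by norm_num),
              ENNReal.ofReal_pow (by norm_num), ENNReal.ofReal_ofNat, ENNReal.ofReal_ofNat]
        _ ≤ ENNReal.ofReal ((1 / 2) ^ k) := by
            refine ENNReal.ofReal_le_ofReal (le_trans ?_ h3)
            gcongr
        _ = _ := by
            rw [ENNReal.ofReal_pow (by norm_num), one_div, ENNReal.ofReal_inv_of_pos (by norm_num),
              ENNReal.ofReal_ofNat]
  filter_upwards [ae_eventually_notMem hsum] with ω hω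
  obtain ⟨M, hM⟩ := eventually_atTop.1 hω
  refine eventually_atTop.2 ⟨M + nB, fun n hn => ?_⟩
  obtain ⟨k, rfl⟩ : ∃ k, n = k + nB := ⟨n - nB, by omega⟩
  simpa only [Set.mem_ofPred_eq, not_not] using hM k (by omega)

theorem ae_tendsto_pairDensity (hHB' : IsNondegenerateBath hHB) : ∀ᵐ ω ∂P,
    Tendsto (fun n => pairDensity hHB α θ n (realisation h g ω)) atTop (𝓝 0) := by
  have h1 : ∀ᵐ ω ∂P, ∀ n, nB ≤ n → ∀ q : _ × _, energy hHB α n (realisation h g ω) q.1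
      + energy hHB α n (realisation h g ω) q.2 ≠ 0 := by
    rw [ae_all_iff]
    intro n
    by_cases hn : nB ≤ n
    · filter_upwards [ae_energy_add_ne_zero hHB (α := α) hHB' hD hn] with ω hω _ using hω
    · exact Eventually.of_forall fun ω h' => absurd h' hn
  have h2 : ∀ᵐ ω ∂P, ∀ i, nB < i → |g i ω| ≤ 1 / 2 := by
    rw [ae_all_iff]
    intro i
    by_cases hi : nB < i
    · filter_upwards [ae_abs_g_le hD hi] with ω hω _ using hω
    · exact Eventually.of_forall fun ω h' => absurd h' hi
  -- Suitable N and K depend on ω. There are countably many, so one null set serves for all of them.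
  have h3 : ∀ᵐ ω ∂P, ∀ N : ℕ, ∀ K : ℕ, nB ≤ N → 1 ≤ N →
      liminf (fun n => (controlled hHB α θ N K (n + N)).indicator
        (pairDensity hHB α θ (n + N)) (realisation h g ω)) atTop = 0 := by
    rw [ae_all_iff]
    intro N
    rw [ae_all_iff]
    intro K
    by_cases hN : nB ≤ N ∧ 1 ≤ N
    · filter_upwards [ae_liminf_pairDensity_eq_zero hHB hθ hθ' hα hα' hD K hN.1 hN.2] with ω hω _ _
        using hω
    · exact Eventually.of_forall fun ω h' h'' => absurd ⟨h', h''⟩ hN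
  filter_upwards [h1, h2, h3, ae_eventually_separated hHB hθ hθ' hα hα' hD] with ω hω1 hω2 hω3 hω4
  obtain ⟨N, hN, hN1, hsep⟩ : ∃ N, nB ≤ N ∧ 1 ≤ N ∧ ∀ n, N ≤ n →
      Separated (threshold α θ n) (energy hHB α n (realisation h g ω)) (h (n + 1) ω) := by
    obtain ⟨N, hN⟩ := eventually_atTop.1 hω4
    exact ⟨max N (max nB 1), by omega, by omega, fun n hn => hN n (by omega)⟩
  -- No pair sum vanishes, so the starting weight is finite and some integer K bounds it.
  have hfin : potential (threshold α θ N) (energy hHB α N (realisation h g ω)) ≠ ⊤ := by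
    rw [potential_eq_ofReal ((threshold_le_quarter hθ hθ' hα hα' N).trans (by norm_num)) (hω1 N hN)]
    exact ENNReal.ofReal_ne_top
  obtain ⟨K, hK⟩ := ENNReal.exists_nat_gt hfin
  have hmem (n : ℕ) : realisation h g ω ∈ controlled hHB α θ N K (n + N) :=
    ⟨hK.le, fun k hk _ => hsep k hk⟩
  have hlim := hω3 N K hN hN1
  simp only [Set.indicator_of_mem (hmem _)] at hlim
  -- The count at most doubles at each step, as does the normalisation 2^n. The limit therefore
  -- exists and equals the liminf.
  have hanti : Antitone fun n => pairDensity hHB α θ (n + N) (realisation h g ω) := by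
    refine antitone_nat_of_succ_le fun n => ?_
    have hcard := card_resonantPairs_succ_le hHB hθ hθ' hα hα' (hN.trans (Nat.le_add_left N n))
      (x := realisation h g ω) (hsep (n + N) (Nat.le_add_left N n))
      (hω2 (n + N + 1) (by omega))
    rw [pairDensity, pairDensity, show n + 1 + N = n + N + 1 by ring]
    calc _ ≤ ((2 * (resonantPairs (threshold α θ (n + N))
            (energy hHB α (n + N) (realisation h g ω))).card : ℕ) : ℝ≥0∞)
              * ENNReal.ofReal ((2 ^ (n + N + 1))⁻¹) := by gcongr
      _ = _ := by
          rw [Nat.cast_mul, mul_comm ((2 : ℕ) : ℝ≥0∞), mul_assoc]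
          congr 1
          rw [← ENNReal.ofReal_natCast, ← ENNReal.ofReal_mul (by positivity)]
          congr 1
          rw [pow_succ]
          push_cast
          field_simp
  rw [← tendsto_add_atTop_iff_nat N]
  have ht := tendsto_atTop_iInf hanti
  rw [ht.liminf_eq] at hlim
  rwa [hlim] at ht

end Decay

/-- Each anti-resonant label is the first component of a resonant pair of indices, whatever the
bijection L n. The reversal translates the increasing enumeration of the levels into the decreasing
one of `eigenvalues₀`. -/
theorem ncard_antiResonant_le {nB : ℕ} {HB : Matrix (Config nB) (Config nB) ℂ}
    (hHB : HB.IsHermitian) (α θ : ℝ) (h g : ℕ → ℝ)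
    (L : ∀ n, Config n ≃ Fin (Fintype.card (Config n))) (n : ℕ) :
    (antiResonant hHB α θ h g L n).ncard
      ≤ (resonantPairs (threshold α θ n) (energy hHB α n (h, g))).card := by
  classical
  have hsub : antiResonant hHB α θ h g L n
      ⊆ ((resonantPairs (threshold α θ n) (energy hHB α n (h, g))).image
        fun q => (L n).symm q.1.rev : Finset (Config n)) := by
    rintro σ ⟨σ', hσ⟩
    rw [Finset.coe_image]
    refine ⟨((L n σ).rev, (L n σ').rev), ?_, by simp⟩
    exact Finset.mem_coe.2 (Finset.mem_filter.2 ⟨Finset.mem_univ _, hσ⟩)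
  refine (Set.ncard_le_ncard hsub (Finset.finite_toSet _)).trans ?_
  rw [Set.ncard_coe_finset]
  exact Finset.card_image_le

end QuantumSun

end

theorem theorem4 (θ : ℝ) (hθ : 2 / 3 < θ) (hθ' : θ < 1) :
    ∃ α₀ : ℝ, 0 < α₀ ∧ α₀ < 1 / 2 ∧ ∀ α : ℝ, 0 ≤ α → α ≤ α₀ →
      ∀ (nB : ℕ) (HB : Matrix (QuantumSun.Config nB) (QuantumSun.Config nB) ℂ)
        (hHB : HB.IsHermitian), QuantumSun.IsNondegenerateBath hHB →
      ∀ {Ω : Type*} [MeasurableSpace Ω] (P : Measure Ω) [IsProbabilityMeasure P]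
        (h g : ℕ → Ω → ℝ), QuantumSun.IsDisorder P nB h g →
      ∀ᵐ ω ∂P, ∀ L : ∀ n, QuantumSun.Config n ≃ Fin (Fintype.card (QuantumSun.Config n)),
        QuantumSun.IsLabeling hHB α (fun i => h i ω) (fun i => g i ω) L →
        Tendsto (fun n : ℕ =>
          ((QuantumSun.antiResonant hHB α θ (fun i => h i ω) (fun i => g i ω) L n).ncard : ℝ)
            / 2 ^ n) atTop (𝓝 0) := by
  have hpos : 0 < 1 - θ := by linarith
  -- This value makes (1 - θ) log α ≤ -20, which beats the factor e^(20n) in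
  -- `perturbation_le_threshold`.
  refine ⟨Real.exp (-(20 / (1 - θ))), Real.exp_pos _, ?_, ?_⟩
  · have h1 : (1 : ℝ) < 20 / (1 - θ) := by rw [lt_div_iff₀ hpos]; linarith
    rw [Real.exp_neg, one_div]
    have h2 := Real.add_one_le_exp (20 / (1 - θ))
    gcongr
    linarith
  intro α hα0 hα' nB HB hHB hHB' Ω _ P _ h g hD
  rcases hα0.eq_or_lt with rfl | hα
  · refine Eventually.of_forall fun ω L _ => ?_
    refine tendsto_const_nhds.congr' ?_
    -- For α = 0 the threshold is 0 as soon as n ≥ 1, so no pair is anti-resonant; at n = 0 it is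
    -- 1/4, since 0^0 = 1.
    filter_upwards [eventually_ge_atTop 1] with n hn
    have hempty : QuantumSun.antiResonant hHB 0 θ (fun i => h i ω) (fun i => g i ω) L n = ∅ := by
      refine Set.eq_empty_of_forall_notMem ?_
      rintro σ ⟨σ', hσ⟩
      have hn' : (0 : ℝ) < n := by exact_mod_cast hn
      have : (0 : ℝ) ^ (θ * n) = 0 := Real.zero_rpow (by positivity)
      simp only [QuantumSun.antiResonantPairs, Set.mem_ofPred_eq, this, zero_div] at hσ
      exact absurd hσ (not_lt.2 (abs_nonneg _))
    simp [hempty]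
  · filter_upwards [QuantumSun.ae_tendsto_pairDensity hHB hθ hθ' hα hα' hD hHB'] with ω hω L _
    have h1 := (ENNReal.tendsto_toReal ENNReal.zero_ne_top).comp hω
    rw [ENNReal.toReal_zero] at h1
    refine squeeze_zero (fun n => by positivity) (fun n => ?_) h1
    have h2 := QuantumSun.ncard_antiResonant_le hHB α θ (fun i => h i ω) (fun i => g i ω) L n
    rw [Function.comp_apply, QuantumSun.pairDensity, ENNReal.toReal_mul, ENNReal.toReal_natCast,
      ENNReal.toReal_ofReal (by positivity), ← div_eq_mul_inv]
    gcongr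
    exact h2
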